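/- Let $S=\{1,\dots,d\}$ and let $\mathcal M(S\times S)$ be the set of Markov distributions on $S\times S$, that is, of the $\nu=[\nu(i,j)]$ with $\nu(i,j)\ge 0$, $\sum_{i,j}\nu(i,j)=1$ and $\nu(k,*):=\sum_j\nu(k,j)=\sum_i\nu(i,k)$ for all $k\in S$. Put $\nu(j|i):=\nu(i,j)/\nu(i,*)$ if $\nu(i,*)>0$, and $\nu(j|i):=0$ for all $j$ otherwise. For a $d\times d$ matrix $M$ with nonnegative entries let $$\rho(M):=\lim_{n\to\infty}\frac1n\log\sum_{i,j}(M^n)_{ij}\in[-\infty,\infty)$$ be its growth rate. For probability mass functions $p,q$ on a finite set and $\alpha>0$, $\alpha\ne1$, put $R_\alpha(p\|q):=\infty$ if $\alpha>1$ and $p\not\preceq q$ (i.e. $q(x)=0<p(x)$ for some $x$), and $R_\alpha(p\|q):=\frac{1}{\alpha(\alpha-1)}\log\sum_{x:\,p(x)q(x)>0}\big(\tfrac{p(x)}{q(x)}\big)^\alpha q(x)$ otherwise (with $\log 0=-\infty$); for $\alpha<0$ put $R_\alpha(p\|q):=R_{1-\alpha}(q\|p)$. For $\nu\in\mathcal M(S\times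 S)$ let $\nu_n$ be the law on $S^n$ of the stationary Markov chain defined by $\nu$: $\nu_1(k)=\nu(k,*)$ and $\nu_n(i_1,\dots,i_n)=\nu(i_1,i_2)\prod_{k=2}^{n-1}\nu(i_{k+1}|i_k)$ for $n\ge2$. For $\nu,\theta\in\mathcal M(S\times S)$ and $\alpha\in\mathbb R\setminus\{0,1\}$ let $$R_\alpha(\nu\|\theta):=\lim_{n\to\infty}\frac1n R_\alpha(\nu_n\|\theta_n)\in[0,\infty]$$ be the Rényi divergence rate. Theorem. Let $\alpha\in\mathbb R\setminus\{0,1\}$ and let $G=[g(i,j)]\in\mathbb R^{d\times d}$. The limits defining $\rho(M)$, for every nonnegative $d\times d$ matrix $M$, and $R_\alpha(\nu\|\theta)$, for all $\nu,\theta\in\mathcal M(S\times S)$, exist in $[-\infty,\infty]$, and $\rho([e^{c\,g(i,j)}\nu(j|i)])$ is finite for every $\nu\in\mathcal M(S\times S)$ and $c\in\mathbb R$. For every $\nu\in\mathcal M(S\times S)$, $$\frac{1}{\alpha-1}\,\rho\big([e^{(\alpha-1)g(i,j)}\nu(j|i)]\big)=\inf_{\theta\in\mathcal M(S\times S)}\Big(\frac1\alpha\,\rho\big([e^{\alpha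 g(i,j)}\theta(j|i)]\big)+R_\alpha(\nu\|\theta)\Big),$$ and for every $\theta\in\mathcal M(S\times S)$, $$\frac1\alpha\,\rho\big([e^{\alpha g(i,j)}\theta(j|i)]\big)=\sup_{\nu\in\mathcal M(S\times S)}\Big(\frac{1}{\alpha-1}\,\rho\big([e^{(\alpha-1)g(i,j)}\nu(j|i)]\big)-R_\alpha(\nu\|\theta)\Big).$$ -/

import Mathlib

open Filter Topology

noncomputable section

/-- The Markov probability distributions on `S × S`, `S = {1, …, d}`: nonnegative, of total mass
one, and with equal first and second marginals. -/
def MarkovDist (d : ℕ) : Set (Matrix (Fin d) (Fin d) ℝ) :=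
  {ν | (∀ i j, 0 ≤ ν i j) ∧ ∑ i, ∑ j, ν i j = 1 ∧ ∀ k, ∑ j, ν k j = ∑ i, ν i k}

/-- The transition probability `ν(j|i)`, with the convention that it is `0` for all `j` if `i` is
not in the support of `ν`. -/
def condProb {d : ℕ} (ν : Matrix (Fin d) (Fin d) ℝ) (i j : Fin d) : ℝ :=
  if 0 < ∑ k, ν i k then ν i j / ∑ k, ν i k else 0

/-- The extended-real logarithm of a nonnegative real number, with value `-∞` at `0`. -/
def elog (x : ℝ) : EReal := ENNReal.log (ENNReal.ofReal x)

/-- The sequence `(1/n) log ∑ᵢⱼ (Mⁿ)ᵢⱼ`. -/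
def growthSeq {d : ℕ} (M : Matrix (Fin d) (Fin d) ℝ) (n : ℕ) : EReal :=
  ((1 / (n : ℝ) : ℝ) : EReal) * elog (∑ i, ∑ j, (M ^ n) i j)

/-- The growth rate `ρ(M)` of a matrix with nonnegative entries. -/
def growthRate {d : ℕ} (M : Matrix (Fin d) (Fin d) ℝ) : EReal :=
  limUnder atTop (growthSeq M)

/-- The law `νₙ` on `Sⁿ` of the first `n` states of the stationary Markov chain defined by `ν`. -/
def chainLaw {d : ℕ} (ν : Matrix (Fin d) (Fin d) ℝ) : (n : ℕ) → (Fin n → Fin d) → ℝ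
  | 0, _ => 1
  | 1, x => ∑ j, ν (x 0) j
  | n + 2, x => ν (x 0) (x 1) * ∏ k : Fin n, condProb ν (x k.castSucc.succ) (x k.succ.succ)

/-- Rényi divergence of order `α > 0`, `α ≠ 1`, between probability mass functions on a finite
set. -/
def renyiPos {X : Type*} [Fintype X] (α : ℝ) (p q : X → ℝ) : EReal :=
  open Classical in
  if 1 < α ∧ ¬ ∀ x, q x = 0 → p x = 0 then ⊤
  else ((1 / (α * (α - 1)) : ℝ) : EReal) *
    elog (∑ x with 0 < p x * q x, (p x / q x) ^ α * q x)

/-- Rényi divergence of order `α ≠ 0, 1` between probability mass functions on a finite set; for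
`α < 0` it is the divergence of order `1 - α` with the arguments interchanged. -/
def renyiDiv {X : Type*} [Fintype X] (α : ℝ) (p q : X → ℝ) : EReal :=
  if 0 < α then renyiPos α p q else renyiPos (1 - α) q p

/-- The sequence `(1/n) R_α(νₙ ‖ θₙ)`. -/
def renyiSeq {d : ℕ} (α : ℝ) (ν θ : Matrix (Fin d) (Fin d) ℝ) (n : ℕ) : EReal :=
  ((1 / (n : ℝ) : ℝ) : EReal) * renyiDiv α (chainLaw ν n) (chainLaw θ n)

/-- The Rényi divergence rate `R_α(ν ‖ θ)` between two stationary Markov chains. -/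
def renyiRate {d : ℕ} (α : ℝ) (ν θ : Matrix (Fin d) (Fin d) ℝ) : EReal :=
  limUnder atTop (renyiSeq α ν θ)

/-- The matrix `[e^{c g(i,j)} ν(j|i)]`. -/
def expTilt {d : ℕ} (c : ℝ) (G ν : Matrix (Fin d) (Fin d) ℝ) : Matrix (Fin d) (Fin d) ℝ :=
  Matrix.of fun i j => Real.exp (c * G i j) * condProb ν i j

end

/-!
If the rate is finite, then `R_α(ν‖θ)` is `1 / (α (α - 1))` times the logarithm of the spectral
radius of the matrix `C = [ν(j|i)^α θ(j|i)^(1 - α)]`, because the Rényi sum of the chain laws is the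
sum of the entries of a power of `C`, up to the initial weights. Tilting `ν` by `e^{(α - 1) g}` and
`θ` by `e^{α g}` multiplies the entries of `C` by `e^{α (α - 1) g} e^{(1 - α) α g} = 1`. So `C` is
the weighted geometric mean `A^α B^(1 - α)` of `A = [e^{(α - 1) g(i,j)} ν(j|i)]` and
`B = [e^{α g(i,j)} θ(j|i)]`, and the inequality between the two sides is Hölder's inequality for the
path sums of these matrices, reversed if `α < 0` or `α > 1`; dividing by `α (α - 1)` gives the same
form in all cases.

Equality holds if `B` is a diagonal conjugate of a multiple of `A`. A Perron eigenvector makes such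
a `B` from any irreducible `A`, with `θ` a stationary chain. If `A` is reducible and `α < 1`, one
restricts `A` to a closed class of maximal growth, `θ` being free to vanish elsewhere. If `α > 1`,
finiteness of the rate forbids that, and one perturbs `A` to a positive matrix instead.

The supremum formula is the infimum formula of order `1 - α` for `-G`.
-/

section Growth

variable {ι : Type*} [Fintype ι] {A B M : Matrix ι ι ℝ}

/-- The sum of the entries of a matrix. On nonnegative matrices it is a submultiplicative norm. -/
def entrySum (M : Matrix ι ι ℝ) : ℝ := ∑ i, ∑ j, M i j

theorem entrySum_mono (h : ∀ i j, A i j ≤ B i j) : entrySum A ≤ entrySum B :=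
  Finset.sum_le_sum fun i _ => Finset.sum_le_sum fun j _ => h i j

theorem exists_entrySum_le_card_mul_rowSum [Nonempty ι] (M : Matrix ι ι ℝ) :
    ∃ i, entrySum M ≤ Fintype.card ι * ∑ j, M i j := by
  obtain ⟨i, hi⟩ := Finite.exists_max fun i => ∑ j, M i j
  refine ⟨i, ?_⟩
  rw [← nsmul_eq_mul]
  exact Finset.sum_le_card_nsmul _ _ _ fun a _ => hi a

theorem apply_le_entrySum (hM : ∀ i j, 0 ≤ M i j) (i j : ι) : M i j ≤ entrySum M :=
  (Finset.single_le_sum (fun j _ => hM i j) (Finset.mem_univ j)).trans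
    (Finset.single_le_sum (f := fun i => ∑ j, M i j)
      (fun i _ => Finset.sum_nonneg fun j _ => hM i j) (Finset.mem_univ i))

theorem entrySum_pos_of_ne_zero (hM : ∀ i j, 0 ≤ M i j) (h : M ≠ 0) : 0 < entrySum M := by
  contrapose! h
  ext i j
  exact le_antisymm ((apply_le_entrySum hM i j).trans h) (hM i j)

theorem entrySum_mul_le (hA : ∀ i j, 0 ≤ A i j) (hB : ∀ i j, 0 ≤ B i j) :
    entrySum (A * B) ≤ entrySum A * entrySum B := by
  have hrow : ∀ k, ∑ j, B k j ≤ entrySum B := fun k =>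
    Finset.single_le_sum (f := fun k => ∑ j, B k j)
      (fun k _ => Finset.sum_nonneg fun j _ => hB k j) (Finset.mem_univ k)
  simp only [entrySum, Matrix.mul_apply, Finset.sum_mul]
  refine Finset.sum_le_sum fun i _ => ?_
  rw [Finset.sum_comm]
  refine Finset.sum_le_sum fun k _ => ?_
  rw [← Finset.mul_sum]
  exact mul_le_mul_of_nonneg_left (hrow k) (hA i k)

theorem exists_pos_forall_eq_zero_or_le {X : Type*} [Finite X] {f : X → ℝ} (hf : ∀ x, 0 ≤ f x) :
    ∃ c > 0, ∀ x, f x = 0 ∨ c ≤ f x := by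
  have h : ∀ᶠ c in 𝓝[>] (0 : ℝ), ∀ x, f x = 0 ∨ c ≤ f x := eventually_all.2 fun x =>
    (hf x).eq_or_lt.elim (fun hx => .of_forall fun _ => .inl hx.symm) fun hx =>
      (eventually_nhdsWithin_of_eventually_nhds (eventually_le_nhds hx)).mono fun _ => .inr
  exact ((eventually_mem_nhdsWithin (s := Set.Ioi (0 : ℝ))).and h).exists

theorem mul_apply_pos (hA : ∀ i j, 0 ≤ A i j) (hB : ∀ i j, 0 ≤ B i j) {i k j : ι}
    (hik : 0 < A i k) (hkj : 0 < B k j) : 0 < (A * B) i j := by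
  rw [Matrix.mul_apply]
  exact Finset.sum_pos' (fun l _ => mul_nonneg (hA i l) (hB l j))
    ⟨k, Finset.mem_univ k, mul_pos hik hkj⟩

theorem exists_pos_of_mul_apply_pos (hA : ∀ i j, 0 ≤ A i j) (hB : ∀ i j, 0 ≤ B i j) {i j : ι}
    (h : 0 < (A * B) i j) : ∃ k, 0 < A i k ∧ 0 < B k j := by
  rw [Matrix.mul_apply] at h
  obtain ⟨k, -, hk⟩ := Finset.exists_ne_zero_of_sum_ne_zero h.ne'
  exact ⟨k, (hA i k).lt_of_ne' (left_ne_zero_of_mul hk),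
    (hB k j).lt_of_ne' (right_ne_zero_of_mul hk)⟩

variable [DecidableEq ι]

theorem pow_apply_pos_of_forall_pos (hA : ∀ i j, 0 ≤ A i j) (hB : ∀ i j, 0 ≤ B i j)
    (h : ∀ i j, 0 < A i j → 0 < B i j) (n : ℕ) {i j : ι} (hn : 0 < (A ^ n) i j) :
    0 < (B ^ n) i j := by
  induction n generalizing j with
  | zero => simpa using hn
  | succ n ih =>
    rw [pow_succ] at hn ⊢
    obtain ⟨k, hik, hkj⟩ := exists_pos_of_mul_apply_pos (Matrix.pow_apply_nonneg hA n) hA hn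
    exact mul_apply_pos (Matrix.pow_apply_nonneg hB n) hB (ih hik) (h k j hkj)

theorem pow_apply_mono (hA : ∀ i j, 0 ≤ A i j) (h : ∀ i j, A i j ≤ B i j) (n : ℕ) (i j : ι) :
    (A ^ n) i j ≤ (B ^ n) i j := by
  induction n generalizing j with
  | zero => simp
  | succ n ih =>
    simp only [pow_succ, Matrix.mul_apply]
    exact Finset.sum_le_sum fun k _ => mul_le_mul (ih k) (h k j) (hA k j)
      ((Matrix.pow_apply_nonneg hA n i k).trans (ih k))

theorem entrySum_pow_pos (hM : ∀ i j, 0 ≤ M i j) (h : ¬ IsNilpotent M) (n : ℕ) :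
    0 < entrySum (M ^ n) :=
  entrySum_pos_of_ne_zero (Matrix.pow_apply_nonneg hM n) fun h0 => h ⟨n, h0⟩

theorem not_isNilpotent_of_forall_pos (hA : ∀ i j, 0 ≤ A i j) (hB : ∀ i j, 0 ≤ B i j)
    (h : ∀ i j, 0 < A i j → 0 < B i j) (hA' : ¬ IsNilpotent A) : ¬ IsNilpotent B := by
  rintro ⟨n, hn⟩
  refine hA' ⟨n, Matrix.ext fun i j => ?_⟩
  by_contra h0
  have := pow_apply_pos_of_forall_pos hA hB h n
    ((Matrix.pow_apply_nonneg hA n i j).lt_of_ne' h0)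
  simp [hn] at this

theorem not_isNilpotent_of_forall_mem_exists_pos (hM : ∀ i j, 0 ≤ M i j) {S : Set ι}
    (hS : S.Nonempty) (h : ∀ i ∈ S, ∃ j ∈ S, 0 < M i j) : ¬ IsNilpotent M := by
  rintro ⟨n, hn⟩
  have key : ∀ n, ∀ i ∈ S, ∃ j ∈ S, 0 < (M ^ n) i j := by
    intro n i hi
    induction n with
    | zero => exact ⟨i, hi, by simp⟩
    | succ n ih =>
      obtain ⟨k, hk, hik⟩ := ih
      obtain ⟨j, hj, hkj⟩ := h k hk
      exact ⟨j, hj, pow_succ M n ▸ mul_apply_pos (Matrix.pow_apply_nonneg hM n) hM hik hkj⟩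
  obtain ⟨i, hi⟩ := hS
  obtain ⟨j, -, hij⟩ := key n i hi
  simp [hn] at hij

theorem pow_apply_eq_zero_or_pow_le (hM : ∀ i j, 0 ≤ M i j) {c : ℝ} (hc : 0 < c)
    (hcM : ∀ i j, M i j = 0 ∨ c ≤ M i j) (n : ℕ) (i j : ι) :
    (M ^ n) i j = 0 ∨ c ^ n ≤ (M ^ n) i j := by
  refine or_iff_not_imp_left.2 fun h0 => ?_
  replace h0 := (Matrix.pow_apply_nonneg hM n i j).lt_of_ne' h0
  induction n generalizing j with
  | zero => by_cases hij : i = j <;> simp_all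
  | succ n ih =>
    rw [pow_succ] at h0
    obtain ⟨k, hik, hkj⟩ := exists_pos_of_mul_apply_pos (Matrix.pow_apply_nonneg hM n) hM h0
    calc c ^ (n + 1) = c ^ n * c := pow_succ c n
      _ ≤ (M ^ n) i k * M k j :=
        mul_le_mul (ih k hik) ((hcM k j).resolve_left hkj.ne') hc.le hik.le
      _ ≤ (M ^ (n + 1)) i j := by
        rw [pow_succ, Matrix.mul_apply]
        exact Finset.single_le_sum (f := fun k => (M ^ n) i k * M k j)
          (fun k _ => mul_nonneg (Matrix.pow_apply_nonneg hM n i k) (hM k j)) (Finset.mem_univ k)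

theorem exists_pow_le_entrySum_pow (hM : ∀ i j, 0 ≤ M i j) (h : ¬ IsNilpotent M) :
    ∃ c > 0, ∀ n, c ^ n ≤ entrySum (M ^ n) := by
  obtain ⟨c, hc, hcM⟩ := exists_pos_forall_eq_zero_or_le (f := fun p : ι × ι => M p.1 p.2)
    fun p => hM p.1 p.2
  refine ⟨c, hc, fun n => ?_⟩
  by_contra! hlt
  exact h ⟨n, Matrix.ext fun i j =>
    (pow_apply_eq_zero_or_pow_le hM hc (fun i j => hcM (i, j)) n i j).resolve_right fun hle =>
      hlt.not_ge (hle.trans (apply_le_entrySum (Matrix.pow_apply_nonneg hM n) i j))⟩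

theorem subadditive_log_entrySum_pow (hM : ∀ i j, 0 ≤ M i j) (h : ¬ IsNilpotent M) :
    Subadditive fun n => Real.log (entrySum (M ^ n)) := fun m n => by
  rw [← Real.log_mul (entrySum_pow_pos hM h m).ne' (entrySum_pow_pos hM h n).ne']
  exact Real.log_le_log (entrySum_pow_pos hM h (m + n)) (pow_add M m n ▸ entrySum_mul_le
    (Matrix.pow_apply_nonneg hM m) (Matrix.pow_apply_nonneg hM n))

theorem bddBelow_log_entrySum_pow_div (hM : ∀ i j, 0 ≤ M i j) (h : ¬ IsNilpotent M) :
    BddBelow (Set.range fun n : ℕ => Real.log (entrySum (M ^ n)) / n) := by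
  obtain ⟨c, hc, hle⟩ := exists_pow_le_entrySum_pow hM h
  refine ⟨min 0 (Real.log c), ?_⟩
  rintro _ ⟨n, rfl⟩
  rcases n.eq_zero_or_pos with rfl | hn
  · simp
  · refine min_le_of_right_le ((le_div_iff₀ (by positivity)).2 ?_)
    rw [mul_comm, ← Real.log_pow]
    exact Real.log_le_log (pow_pos hc n) (hle n)

/-- The exponential growth rate of the powers of a nonnegative matrix, as a real number. It is
meaningful only if the matrix is not nilpotent; otherwise `Real.log 0 = 0` makes it `0`. -/
noncomputable def growthExp (M : Matrix ι ι ℝ) : ℝ :=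
  limUnder atTop fun n : ℕ => Real.log (entrySum (M ^ n)) / n

theorem tendsto_growthExp (hM : ∀ i j, 0 ≤ M i j) (h : ¬ IsNilpotent M) :
    Tendsto (fun n : ℕ => Real.log (entrySum (M ^ n)) / n) atTop (𝓝 (growthExp M)) :=
  tendsto_nhds_limUnder ⟨_, (subadditive_log_entrySum_pow hM h).tendsto_lim
    (bddBelow_log_entrySum_pow_div hM h)⟩

theorem growthExp_le_log_div (hM : ∀ i j, 0 ≤ M i j) (h : ¬ IsNilpotent M) {n : ℕ} (hn : n ≠ 0) :
    growthExp M ≤ Real.log (entrySum (M ^ n)) / n := by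
  have hbdd := bddBelow_log_entrySum_pow_div hM h
  rw [tendsto_nhds_unique (tendsto_growthExp hM h)
    ((subadditive_log_entrySum_pow hM h).tendsto_lim hbdd)]
  exact (subadditive_log_entrySum_pow hM h).lim_le_div hbdd hn

theorem growthExp_le_add_log (hA : ∀ i j, 0 ≤ A i j) (hB : ∀ i j, 0 ≤ B i j)
    (hA' : ¬ IsNilpotent A) (hB' : ¬ IsNilpotent B) {b c : ℝ} (hc : 0 < c)
    (h : ∃ᶠ n in atTop, entrySum (A ^ n) ≤ b * c ^ n * entrySum (B ^ n)) :
    growthExp A ≤ growthExp B + Real.log c := by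
  have hb : 0 < b := by
    obtain ⟨n, hn⟩ := h.exists
    have := (entrySum_pow_pos hA hA' n).trans_le hn
    exact pos_of_mul_pos_left (pos_of_mul_pos_left this (entrySum_pow_pos hB hB' n).le)
      (pow_pos hc n).le
  have hlim : Tendsto (fun n : ℕ => Real.log (entrySum (A ^ n)) / n
      - Real.log (entrySum (B ^ n)) / n - Real.log b / n) atTop
      (𝓝 (growthExp A - growthExp B - 0)) :=
    ((tendsto_growthExp hA hA').sub (tendsto_growthExp hB hB')).sub
      (tendsto_const_div_atTop_nhds_zero_nat _)
  have hle : ∃ᶠ n : ℕ in atTop, Real.log (entrySum (A ^ n)) / n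
      - Real.log (entrySum (B ^ n)) / n - Real.log b / n ≤ Real.log c := by
    refine (h.and_eventually (eventually_gt_atTop 0)).mono fun n ⟨hn, hn0⟩ => ?_
    have hlog := Real.log_le_log (entrySum_pow_pos hA hA' n) hn
    rw [Real.log_mul (by positivity) (entrySum_pow_pos hB hB' n).ne',
      Real.log_mul hb.ne' (by positivity), Real.log_pow] at hlog
    rw [← sub_div, ← sub_div, div_le_iff₀ (Nat.cast_pos.2 hn0)]
    linarith
  linarith [le_of_tendsto_of_frequently hlim hle]

theorem growthExp_mono (hA : ∀ i j, 0 ≤ A i j) (hA' : ¬ IsNilpotent A)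
    (h : ∀ i j, A i j ≤ B i j) : growthExp A ≤ growthExp B := by
  have hB : ∀ i j, 0 ≤ B i j := fun i j => (hA i j).trans (h i j)
  have hB' := not_isNilpotent_of_forall_pos hA hB (fun i j hij => hij.trans_le (h i j)) hA'
  simpa using growthExp_le_add_log hA hB hA' hB' (b := 1) one_pos (.of_forall fun n => by
    simpa using entrySum_mono (pow_apply_mono hA h n))

theorem exists_growthExp_add_smul_le {E : Matrix ι ι ℝ} (hM : ∀ i j, 0 ≤ M i j)
    (hE : ∀ i j, 0 ≤ E i j) (hM' : ¬ IsNilpotent M) {δ : ℝ} (hδ : 0 < δ) :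
    ∃ ε > (0 : ℝ), growthExp (M + ε • E) ≤ growthExp M + δ := by
  obtain ⟨n, hn, hn0⟩ := (((tendsto_growthExp hM hM').eventually_lt_const
    (lt_add_of_pos_right (growthExp M) hδ)).and (eventually_gt_atTop 0)).exists
  have hcont : Tendsto (fun ε : ℝ => Real.log (entrySum ((M + ε • E) ^ n)) / n) (𝓝[>] 0)
      (𝓝 (Real.log (entrySum (M ^ n)) / n)) := by
    have hc : Continuous fun ε : ℝ => entrySum ((M + ε • E) ^ n) :=
      continuous_finsetSum _ fun i _ => continuous_finsetSum _ fun j _ =>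
        Continuous.matrix_elem (by fun_prop) i j
    have := (hc.tendsto 0).mono_left (nhdsWithin_le_nhds (s := Set.Ioi 0))
    simp only [zero_smul, add_zero] at this
    exact (this.log (entrySum_pow_pos hM hM' n).ne').div_const _
  obtain ⟨ε, hε, hε0⟩ := ((hcont.eventually_lt_const hn).and
    (eventually_mem_nhdsWithin (s := Set.Ioi (0 : ℝ)))).exists
  have hε0 : 0 < ε := hε0
  have hle : ∀ i j, M i j ≤ (M + ε • E) i j := fun i j =>
    le_add_of_nonneg_right (mul_nonneg hε0.le (hE i j))
  have hnonneg : ∀ i j, 0 ≤ (M + ε • E) i j := fun i j => (hM i j).trans (hle i j)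
  exact ⟨ε, hε0, (growthExp_le_log_div hnonneg (not_isNilpotent_of_forall_pos hM hnonneg
    (fun i j hij => hij.trans_le (hle i j)) hM') hn0.ne').trans hε.le⟩

end Growth

section GrowthRate

variable {d : ℕ} {M : Matrix (Fin d) (Fin d) ℝ}

theorem elog_of_pos {x : ℝ} (hx : 0 < x) : elog x = (Real.log x : ℝ) :=
  ENNReal.log_ofReal_of_pos hx

theorem elog_zero : elog 0 = ⊥ := by simp [elog]

theorem tendsto_growthSeq (hM : ∀ i j, 0 ≤ M i j) (h : ¬ IsNilpotent M) :
    Tendsto (growthSeq M) atTop (𝓝 (growthExp M : EReal)) := by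
  refine (EReal.tendsto_coe.2 (tendsto_growthExp hM h)).congr fun n => ?_
  change _ = _ * elog (entrySum (M ^ n))
  rw [elog_of_pos (entrySum_pow_pos hM h n), ← EReal.coe_mul, one_div_mul_eq_div]

theorem tendsto_growthSeq_bot (h : IsNilpotent M) : Tendsto (growthSeq M) atTop (𝓝 ⊥) := by
  obtain ⟨m, hm⟩ := h
  refine tendsto_const_nhds.congr' ?_
  filter_upwards [eventually_ge_atTop m, eventually_gt_atTop 0] with n hmn hn
  simp only [growthSeq, pow_eq_zero_of_le hmn hm, Matrix.zero_apply, Finset.sum_const_zero,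
    elog_zero]
  rw [EReal.coe_mul_bot_of_pos (by positivity)]

theorem exists_tendsto_growthSeq (hM : ∀ i j, 0 ≤ M i j) :
    ∃ l : EReal, Tendsto (growthSeq M) atTop (𝓝 l) := by
  by_cases h : IsNilpotent M
  exacts [⟨_, tendsto_growthSeq_bot h⟩, ⟨_, tendsto_growthSeq hM h⟩]

theorem growthRate_eq_growthExp (hM : ∀ i j, 0 ≤ M i j) (h : ¬ IsNilpotent M) :
    growthRate M = (growthExp M : EReal) :=
  (tendsto_growthSeq hM h).limUnder_eq

end GrowthRate

section DiagConj

variable {ι : Type*} {A B M : Matrix ι ι ℝ} {w : ι → ℝ} {c : ℝ}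

/-- The conjugate `c D⁻¹ M D` of `M` by the diagonal matrix `D` with diagonal `w`, scaled by `c`. -/
noncomputable def diagConj (c : ℝ) (w : ι → ℝ) (M : Matrix ι ι ℝ) : Matrix ι ι ℝ :=
  Matrix.of fun i j => c * (M i j * (w j / w i))

theorem diagConj_apply (c : ℝ) (w : ι → ℝ) (M : Matrix ι ι ℝ) (i j : ι) :
    diagConj c w M i j = c * (M i j * (w j / w i)) := rfl

theorem diagConj_nonneg (hc : 0 < c) (hw : ∀ i, 0 < w i) (hM : ∀ i j, 0 ≤ M i j) (i j : ι) :
    0 ≤ diagConj c w M i j :=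
  mul_nonneg hc.le (mul_nonneg (hM i j) (div_pos (hw j) (hw i)).le)

theorem diagConj_pos_iff (hc : 0 < c) (hw : ∀ i, 0 < w i) {i j : ι} :
    0 < diagConj c w M i j ↔ 0 < M i j := by
  rw [diagConj_apply, mul_pos_iff_of_pos_left hc, mul_pos_iff_of_pos_right (div_pos (hw j) (hw i))]

theorem diagConj_inv_diagConj (hc : 0 < c) (hw : ∀ i, 0 < w i) :
    diagConj c⁻¹ w⁻¹ (diagConj c w M) = M := by
  ext i j
  have hi := (hw i).ne'
  have hj := (hw j).ne'
  simp only [diagConj_apply, Pi.inv_apply]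
  field_simp

variable [Fintype ι]

theorem diagConj_mul_diagConj (c₁ c₂ : ℝ) (hw : ∀ i, 0 < w i) :
    diagConj c₁ w A * diagConj c₂ w B = diagConj (c₁ * c₂) w (A * B) := by
  ext i j
  simp only [diagConj_apply, Matrix.mul_apply, Finset.sum_mul, Finset.mul_sum]
  refine Finset.sum_congr rfl fun k _ => ?_
  have hk := (hw k).ne'
  field_simp

theorem exists_entrySum_diagConj_le (w : ι → ℝ) :
    ∃ b, ∀ c : ℝ, 0 < c → ∀ M : Matrix ι ι ℝ, (∀ i j, 0 ≤ M i j) →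
      entrySum (diagConj c w M) ≤ b * c * entrySum M := by
  obtain ⟨b, hb⟩ := Finite.exists_le fun p : ι × ι => w p.2 / w p.1
  refine ⟨b, fun c hc M hM => ?_⟩
  simp only [entrySum, Finset.mul_sum]
  refine Finset.sum_le_sum fun i _ => Finset.sum_le_sum fun j _ => ?_
  rw [diagConj_apply, mul_comm b, mul_assoc, mul_comm b]
  exact mul_le_mul_of_nonneg_left (mul_le_mul_of_nonneg_left (hb (i, j)) (hM i j)) hc.le

variable [DecidableEq ι]

theorem diagConj_pow (c : ℝ) (hw : ∀ i, 0 < w i) (n : ℕ) :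
    diagConj c w M ^ n = diagConj (c ^ n) w (M ^ n) := by
  induction n with
  | zero =>
    ext i j
    by_cases hij : i = j
    · simp [diagConj_apply, hij, (hw j).ne']
    · simp [diagConj_apply, hij]
  | succ n ih => rw [pow_succ, ih, diagConj_mul_diagConj _ _ hw, pow_succ, pow_succ]

theorem not_isNilpotent_diagConj (hc : 0 < c) (hw : ∀ i, 0 < w i) (hM : ∀ i j, 0 ≤ M i j)
    (h : ¬ IsNilpotent M) : ¬ IsNilpotent (diagConj c w M) :=
  not_isNilpotent_of_forall_pos hM (diagConj_nonneg hc hw hM)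
    (fun _ _ => (diagConj_pos_iff hc hw).2) h

theorem growthExp_diagConj_le (hc : 0 < c) (hw : ∀ i, 0 < w i) (hM : ∀ i j, 0 ≤ M i j)
    (h : ¬ IsNilpotent M) : growthExp (diagConj c w M) ≤ growthExp M + Real.log c := by
  obtain ⟨b, hb⟩ := exists_entrySum_diagConj_le w
  refine growthExp_le_add_log (diagConj_nonneg hc hw hM) hM (not_isNilpotent_diagConj hc hw hM h)
    h hc (b := b) (.of_forall fun n => ?_)
  rw [diagConj_pow c hw]
  exact hb _ (pow_pos hc n) _ (Matrix.pow_apply_nonneg hM n)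

theorem growthExp_diagConj (hc : 0 < c) (hw : ∀ i, 0 < w i) (hM : ∀ i j, 0 ≤ M i j)
    (h : ¬ IsNilpotent M) : growthExp (diagConj c w M) = growthExp M + Real.log c := by
  refine (growthExp_diagConj_le hc hw hM h).antisymm ?_
  have := growthExp_diagConj_le (inv_pos.2 hc) (w := w⁻¹) (fun i => inv_pos.2 (hw i))
    (diagConj_nonneg hc hw hM) (not_isNilpotent_diagConj hc hw hM h)
  rw [diagConj_inv_diagConj hc hw, Real.log_inv] at this
  linarith

end DiagConj

section GeomMean

variable {ι : Type*} {A B A' B' M : Matrix ι ι ℝ} {α : ℝ}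

/-- The weighted entrywise geometric mean `A ^ α * B ^ (1 - α)`, for an arbitrary real weight
`α`. -/
noncomputable def geomMean (α : ℝ) (A B : Matrix ι ι ℝ) : Matrix ι ι ℝ :=
  Matrix.of fun i j => A i j ^ α * B i j ^ (1 - α)

theorem geomMean_apply (α : ℝ) (A B : Matrix ι ι ℝ) (i j : ι) :
    geomMean α A B i j = A i j ^ α * B i j ^ (1 - α) := rfl

theorem geomMean_nonneg (hA : ∀ i j, 0 ≤ A i j) (hB : ∀ i j, 0 ≤ B i j) (i j : ι) :
    0 ≤ geomMean α A B i j :=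
  mul_nonneg (Real.rpow_nonneg (hA i j) _) (Real.rpow_nonneg (hB i j) _)

theorem geomMean_one_sub (α : ℝ) (A B : Matrix ι ι ℝ) :
    geomMean (1 - α) B A = geomMean α A B := by
  ext i j
  rw [geomMean_apply, geomMean_apply, sub_sub_cancel, mul_comm]

theorem geomMean_inv_geomMean (hα0 : α ≠ 0) (hα1 : α ≠ 1) (hA : ∀ i j, 0 ≤ A i j)
    (hB : ∀ i j, 0 ≤ B i j) (hBA : ∀ i j, B i j = 0 → A i j = 0) :
    geomMean α⁻¹ (geomMean α A B) B = A := by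
  ext i j
  have : 1 - α ≠ 0 := sub_ne_zero.2 hα1.symm
  rw [geomMean_apply, geomMean_apply]
  rcases (hB i j).eq_or_lt with hb | hb
  · simp [hBA i j hb.symm, hα0, Real.zero_rpow]
  · rw [Real.mul_rpow (Real.rpow_nonneg (hA i j) _) (Real.rpow_nonneg hb.le _),
      Real.rpow_rpow_inv (hA i j) hα0, ← Real.rpow_mul hb.le, mul_assoc, ← Real.rpow_add hb,
      show (1 - α) * α⁻¹ + (1 - α⁻¹) = 0 by field_simp; ring, Real.rpow_zero, mul_one]

theorem geomMean_self_diagConj {c : ℝ} {w : ι → ℝ} (hc : 0 < c) (hw : ∀ i, 0 < w i)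
    (hM : ∀ i j, 0 ≤ M i j) :
    geomMean α M (diagConj c w M) = diagConj (c ^ (1 - α)) (fun i => w i ^ (1 - α)) M := by
  ext i j
  have hwij := div_pos (hw j) (hw i)
  simp only [geomMean_apply, diagConj_apply]
  rw [Real.mul_rpow hc.le (mul_nonneg (hM i j) hwij.le), Real.mul_rpow (hM i j) hwij.le,
    Real.div_rpow (hw j).le (hw i).le]
  have hself : M i j ^ α * M i j ^ (1 - α) = M i j := by
    rw [← Real.rpow_add' (hM i j) (by simp)]; simp
  calc _ = c ^ (1 - α) * ((M i j ^ α * M i j ^ (1 - α)) * (w j ^ (1 - α) / w i ^ (1 - α))) := by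
        ring
    _ = _ := by rw [hself]

/-- The term `x ^ α * y ^ (1 - α)` of a Rényi divergence, for `x, y ≥ 0`, is finite when it is
computed in `[0, ∞]`. The real power does not see this, since it has `0 ^ β = 0` for `β < 0`. -/
def RenyiFinite (α x y : ℝ) : Prop :=
  (1 < α → y = 0 → x = 0) ∧ (α < 0 → x = 0 → y = 0)

theorem renyiFinite_one_sub_iff {x y : ℝ} : RenyiFinite (1 - α) y x ↔ RenyiFinite α x y :=
  ⟨fun h => ⟨fun hα => h.2 (by linarith), fun hα => h.1 (by linarith)⟩,
    fun h => ⟨fun hα => h.2 (by linarith), fun hα => h.1 (by linarith)⟩⟩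

theorem not_isNilpotent_geomMean [Fintype ι] [DecidableEq ι] (hA : ∀ i j, 0 ≤ A i j)
    (hB : ∀ i j, 0 ≤ B i j) (hA' : ¬ IsNilpotent A) (hAB : ∀ i j, 0 < A i j → 0 < B i j) :
    ¬ IsNilpotent (geomMean α A B) :=
  not_isNilpotent_of_forall_pos hA (geomMean_nonneg hA hB) (fun i j hij =>
    mul_pos (Real.rpow_pos_of_pos hij _) (Real.rpow_pos_of_pos (hAB i j hij) _)) hA'

theorem sum_rpow_mul_rpow_le {X : Type*} (s : Finset X) {f g : X → ℝ} (hf : ∀ x, 0 ≤ f x)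
    (hg : ∀ x, 0 ≤ g x) (hα0 : 0 < α) (hα1 : α < 1) :
    ∑ x ∈ s, f x ^ α * g x ^ (1 - α) ≤ (∑ x ∈ s, f x) ^ α * (∑ x ∈ s, g x) ^ (1 - α) := by
  have hα1' := sub_pos.2 hα1
  have hpq : (1 / α).HolderConjugate (1 / (1 - α)) :=
    Real.holderConjugate_iff.2 ⟨(one_lt_div hα0).2 hα1, by simp⟩
  simpa [← Real.rpow_mul, hf, hg, mul_inv_cancel₀ hα0.ne', mul_inv_cancel₀ hα1'.ne'] using
    Real.inner_le_Lp_mul_Lq_of_nonneg s hpq (f := fun x => f x ^ α) (g := fun x => g x ^ (1 - α))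
      (fun x _ => Real.rpow_nonneg (hf x) _) (fun x _ => Real.rpow_nonneg (hg x) _)

variable [Fintype ι]

theorem entrySum_geomMean_le (hα0 : 0 < α) (hα1 : α < 1) (hA : ∀ i j, 0 ≤ A i j)
    (hB : ∀ i j, 0 ≤ B i j) :
    entrySum (geomMean α A B) ≤ entrySum A ^ α * entrySum B ^ (1 - α) := by
  have hsum : ∀ M : Matrix ι ι ℝ, entrySum M = ∑ p : ι × ι, M p.1 p.2 :=
    fun M => (Fintype.sum_prod_type' M).symm
  simp only [hsum]
  exact sum_rpow_mul_rpow_le _ (fun p => hA p.1 p.2) (fun p => hB p.1 p.2) hα0 hα1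

theorem geomMean_mul_geomMean_le (hα0 : 0 < α) (hα1 : α < 1) (hA : ∀ i j, 0 ≤ A i j)
    (hB : ∀ i j, 0 ≤ B i j) (hA' : ∀ i j, 0 ≤ A' i j) (hB' : ∀ i j, 0 ≤ B' i j) (i j : ι) :
    (geomMean α A B * geomMean α A' B') i j ≤ geomMean α (A * A') (B * B') i j := by
  calc (geomMean α A B * geomMean α A' B') i j
      = ∑ k, (A i k * A' k j) ^ α * (B i k * B' k j) ^ (1 - α) := by
        rw [Matrix.mul_apply]
        refine Finset.sum_congr rfl fun k _ => ?_
        rw [geomMean_apply, geomMean_apply, mul_mul_mul_comm, Real.mul_rpow (hA i k) (hA' k j),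
          Real.mul_rpow (hB i k) (hB' k j)]
    _ ≤ geomMean α (A * A') (B * B') i j :=
        sum_rpow_mul_rpow_le _ (fun k => mul_nonneg (hA i k) (hA' k j))
          (fun k => mul_nonneg (hB i k) (hB' k j)) hα0 hα1

variable [DecidableEq ι]

theorem geomMean_pow_le (hα0 : 0 < α) (hα1 : α < 1) (hA : ∀ i j, 0 ≤ A i j)
    (hB : ∀ i j, 0 ≤ B i j) (n : ℕ) (i j : ι) :
    (geomMean α A B ^ n) i j ≤ geomMean α (A ^ n) (B ^ n) i j := by
  induction n generalizing j with
  | zero =>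
    by_cases hij : i = j
    · simp [geomMean_apply, hij]
    · simp [geomMean_apply, hij, hα0.ne']
  | succ n ih =>
    simp only [pow_succ]
    refine le_trans ?_ (geomMean_mul_geomMean_le hα0 hα1 (Matrix.pow_apply_nonneg hA n)
      (Matrix.pow_apply_nonneg hB n) hA hB i j)
    simp only [Matrix.mul_apply]
    exact Finset.sum_le_sum fun k _ =>
      mul_le_mul_of_nonneg_right (ih k) (geomMean_nonneg hA hB k j)

theorem growthExp_geomMean_le (hα0 : 0 < α) (hα1 : α < 1) (hA : ∀ i j, 0 ≤ A i j)
    (hB : ∀ i j, 0 ≤ B i j) (hA' : ¬ IsNilpotent A) (hB' : ¬ IsNilpotent B)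
    (hC : ¬ IsNilpotent (geomMean α A B)) :
    growthExp (geomMean α A B) ≤ α * growthExp A + (1 - α) * growthExp B := by
  refine le_of_tendsto_of_tendsto' (tendsto_growthExp (geomMean_nonneg hA hB) hC)
    (((tendsto_growthExp hA hA').const_mul α).add
      ((tendsto_growthExp hB hB').const_mul (1 - α))) fun n => ?_
  have hAn := entrySum_pow_pos hA hA' n
  have hBn := entrySum_pow_pos hB hB' n
  have hle := Real.log_le_log (entrySum_pow_pos (geomMean_nonneg hA hB) hC n)
    ((entrySum_mono (geomMean_pow_le hα0 hα1 hA hB n)).trans (entrySum_geomMean_le hα0 hα1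
      (Matrix.pow_apply_nonneg hA n) (Matrix.pow_apply_nonneg hB n)))
  rw [Real.log_mul (Real.rpow_pos_of_pos hAn _).ne' (Real.rpow_pos_of_pos hBn _).ne',
    Real.log_rpow hAn, Real.log_rpow hBn] at hle
  calc _ ≤ (α * Real.log (entrySum (A ^ n)) + (1 - α) * Real.log (entrySum (B ^ n))) / n :=
        div_le_div_of_nonneg_right hle n.cast_nonneg
    _ = _ := by ring

theorem le_growthExp_geomMean (hα : 1 < α) (hA : ∀ i j, 0 ≤ A i j) (hB : ∀ i j, 0 ≤ B i j)
    (hA' : ¬ IsNilpotent A) (hB' : ¬ IsNilpotent B) (hC : ¬ IsNilpotent (geomMean α A B))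
    (hBA : ∀ i j, B i j = 0 → A i j = 0) :
    α * growthExp A + (1 - α) * growthExp B ≤ growthExp (geomMean α A B) := by
  have hα0 : 0 < α := one_pos.trans hα
  have hinv := geomMean_inv_geomMean hα0.ne' hα.ne' hA hB hBA
  have hle := growthExp_geomMean_le (inv_pos.2 hα0) (inv_lt_one_of_one_lt₀ hα)
    (geomMean_nonneg hA hB) hB hC hB' (hinv.symm ▸ hA')
  rw [hinv] at hle
  have := mul_le_mul_of_nonneg_left hle hα0.le
  rw [mul_add, mul_inv_cancel_left₀ hα0.ne', ← mul_assoc, mul_sub, mul_inv_cancel₀ hα0.ne'] at this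
  linarith

theorem growthExp_div_le (hα0 : α ≠ 0) (hα1 : α ≠ 1) (hA : ∀ i j, 0 ≤ A i j)
    (hB : ∀ i j, 0 ≤ B i j) (hA' : ¬ IsNilpotent A) (hB' : ¬ IsNilpotent B)
    (hC : ¬ IsNilpotent (geomMean α A B)) (h : ∀ i j, RenyiFinite α (A i j) (B i j)) :
    growthExp A / (α - 1) ≤
      growthExp B / α + growthExp (geomMean α A B) / (α * (α - 1)) := by
  have hα1' := sub_ne_zero.2 hα1
  have key : growthExp B / α + growthExp (geomMean α A B) / (α * (α - 1)) - growthExp A / (α - 1)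
      = (growthExp (geomMean α A B) - (α * growthExp A + (1 - α) * growthExp B))
        / (α * (α - 1)) := by
    field_simp
    ring
  rw [← sub_nonneg, key]
  rcases lt_or_gt_of_ne hα0 with hα0 | hα0
  · have hle := le_growthExp_geomMean (α := 1 - α) (by linarith) hB hA hB' hA'
      (by rwa [geomMean_one_sub]) fun i j => (h i j).2 hα0
    rw [geomMean_one_sub] at hle
    exact div_nonneg (by linarith) (mul_nonneg_of_nonpos_of_nonpos hα0.le (by linarith))
  rcases lt_or_gt_of_ne hα1 with hα1 | hα1
  · exact div_nonneg_of_nonpos (sub_nonpos.2 (growthExp_geomMean_le hα0 hα1 hA hB hA' hB' hC))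
      (mul_nonpos_of_nonneg_of_nonpos hα0.le (by linarith))
  · exact div_nonneg (sub_nonneg.2 (le_growthExp_geomMean hα1 hA hB hA' hB' hC
      fun i j => (h i j).1 hα1)) (mul_nonneg hα0.le (by linarith))

end GeomMean

section Markov

variable {d : ℕ} {ν θ : Matrix (Fin d) (Fin d) ℝ} {i j : Fin d}

/-- The transition matrix `[ν(j|i)]`. -/
noncomputable abbrev transMatrix (ν : Matrix (Fin d) (Fin d) ℝ) : Matrix (Fin d) (Fin d) ℝ :=
  Matrix.of (condProb ν)

theorem rowSum_nonneg (hν : ν ∈ MarkovDist d) (i : Fin d) : 0 ≤ ∑ k, ν i k :=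
  Finset.sum_nonneg fun k _ => hν.1 i k

theorem rowSum_pos_of_pos (hν : ν ∈ MarkovDist d) (h : 0 < ν i j) : 0 < ∑ k, ν i k :=
  Finset.sum_pos' (fun k _ => hν.1 i k) ⟨j, Finset.mem_univ j, h⟩

theorem rowSum_pos_of_pos' (hν : ν ∈ MarkovDist d) (h : 0 < ν i j) : 0 < ∑ k, ν j k := by
  rw [hν.2.2 j]
  exact Finset.sum_pos' (fun k _ => hν.1 k j) ⟨i, Finset.mem_univ i, h⟩

theorem exists_pos_of_rowSum_pos (h : 0 < ∑ k, ν i k) : ∃ j, 0 < ν i j := by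
  simpa using Finset.exists_lt_of_sum_lt (s := Finset.univ) (f := fun _ => 0) (g := ν i) (by simpa)

theorem exists_rowSum_pos (hν : ν ∈ MarkovDist d) : ∃ i, 0 < ∑ k, ν i k := by
  simpa using Finset.exists_lt_of_sum_lt (s := Finset.univ) (f := fun _ => 0)
    (g := fun i => ∑ k, ν i k) (by simp [hν.2.1])

theorem condProb_nonneg (hν : ν ∈ MarkovDist d) (i j : Fin d) : 0 ≤ condProb ν i j := by
  unfold condProb
  split_ifs with h
  exacts [div_nonneg (hν.1 i j) h.le, le_rfl]

theorem condProb_pos_iff (hν : ν ∈ MarkovDist d) : 0 < condProb ν i j ↔ 0 < ν i j := by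
  unfold condProb
  split_ifs with h
  · exact div_pos_iff_of_pos_right h
  · exact iff_of_false (lt_irrefl 0) fun hij => h (rowSum_pos_of_pos hν hij)

theorem condProb_eq_zero_iff (hν : ν ∈ MarkovDist d) : condProb ν i j = 0 ↔ ν i j = 0 := by
  rw [← (condProb_nonneg hν i j).not_lt_iff_eq', condProb_pos_iff hν,
    (hν.1 i j).not_lt_iff_eq']

theorem rowSum_mul_condProb (hν : ν ∈ MarkovDist d) (i j : Fin d) :
    (∑ k, ν i k) * condProb ν i j = ν i j := by
  by_cases h : 0 < ∑ k, ν i k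
  · rw [condProb, if_pos h, mul_div_cancel₀ _ h.ne']
  · rw [condProb, if_neg h, mul_zero]
    exact (hν.1 i j).eq_of_not_lt fun hij => h (rowSum_pos_of_pos hν hij)

theorem not_isNilpotent_of_mem_markovDist (hν : ν ∈ MarkovDist d) : ¬ IsNilpotent ν :=
  not_isNilpotent_of_forall_mem_exists_pos hν.1 (S := {i | 0 < ∑ k, ν i k})
    (exists_rowSum_pos hν) fun _ hi =>
      (exists_pos_of_rowSum_pos hi).imp fun _ hij => ⟨rowSum_pos_of_pos' hν hij, hij⟩

theorem not_isNilpotent_transMatrix (hν : ν ∈ MarkovDist d) : ¬ IsNilpotent (transMatrix ν) :=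
  not_isNilpotent_of_forall_pos hν.1 (condProb_nonneg hν)
    (fun _ _ => (condProb_pos_iff hν).2) (not_isNilpotent_of_mem_markovDist hν)

variable (c : ℝ) (G : Matrix (Fin d) (Fin d) ℝ)

theorem expTilt_nonneg (hν : ν ∈ MarkovDist d) (i j : Fin d) : 0 ≤ expTilt c G ν i j :=
  mul_nonneg (Real.exp_pos _).le (condProb_nonneg hν i j)

theorem expTilt_pos_iff (hν : ν ∈ MarkovDist d) : 0 < expTilt c G ν i j ↔ 0 < ν i j :=
  (mul_pos_iff_of_pos_left (Real.exp_pos _)).trans (condProb_pos_iff hν)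

theorem expTilt_eq_zero_iff (hν : ν ∈ MarkovDist d) : expTilt c G ν i j = 0 ↔ ν i j = 0 :=
  (mul_eq_zero_iff_left (Real.exp_ne_zero _)).trans (condProb_eq_zero_iff hν)

theorem not_isNilpotent_expTilt (hν : ν ∈ MarkovDist d) : ¬ IsNilpotent (expTilt c G ν) :=
  not_isNilpotent_of_forall_pos hν.1 (expTilt_nonneg c G hν)
    (fun _ _ => (expTilt_pos_iff c G hν).2) (not_isNilpotent_of_mem_markovDist hν)

theorem growthRate_expTilt (hν : ν ∈ MarkovDist d) :
    growthRate (expTilt c G ν) = (growthExp (expTilt c G ν) : EReal) :=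
  growthRate_eq_growthExp (expTilt_nonneg c G hν) (not_isNilpotent_expTilt c G hν)

theorem geomMean_expTilt (α : ℝ) (hν : ν ∈ MarkovDist d) (hθ : θ ∈ MarkovDist d) :
    geomMean α (expTilt (α - 1) G ν) (expTilt α G θ) =
      geomMean α (transMatrix ν) (transMatrix θ) := by
  ext i j
  change (_ * condProb ν i j) ^ α * (_ * condProb θ i j) ^ (1 - α) = _
  rw [Real.mul_rpow (Real.exp_pos _).le (condProb_nonneg hν i j),
    Real.mul_rpow (Real.exp_pos _).le (condProb_nonneg hθ i j), mul_mul_mul_comm,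
    ← Real.exp_mul, ← Real.exp_mul, ← Real.exp_add,
    show (α - 1) * G i j * α + α * G i j * (1 - α) = 0 by ring, Real.exp_zero, one_mul]
  rfl

end Markov

section RenyiDivergence

variable {X : Type*} [Fintype X] {α : ℝ} {p q : X → ℝ}

theorem sum_div_rpow_mul (hα0 : α ≠ 0) (hα1 : α ≠ 1) (hp : ∀ x, 0 ≤ p x) (hq : ∀ x, 0 ≤ q x) :
    ∑ x with 0 < p x * q x, (p x / q x) ^ α * q x = ∑ x, p x ^ α * q x ^ (1 - α) := by
  rw [Finset.sum_filter]
  refine Finset.sum_congr rfl fun x _ => ?_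
  rcases (hp x).eq_or_lt with hpx | hpx
  · simp [← hpx, hα0]
  rcases (hq x).eq_or_lt with hqx | hqx
  · simp [← hqx, sub_ne_zero.2 hα1.symm]
  rw [if_pos (mul_pos hpx hqx), Real.div_rpow hpx.le hqx.le, Real.rpow_sub hqx, Real.rpow_one]
  ring

theorem renyiPos_eq (hα0 : α ≠ 0) (hα1 : α ≠ 1) (hp : ∀ x, 0 ≤ p x) (hq : ∀ x, 0 ≤ q x)
    (h : 1 < α → ∀ x, q x = 0 → p x = 0) :
    renyiPos α p q = ((1 / (α * (α - 1)) : ℝ) : EReal) *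
      elog (∑ x, p x ^ α * q x ^ (1 - α)) := by
  rw [renyiPos, if_neg fun h' => h'.2 (h h'.1), sum_div_rpow_mul hα0 hα1 hp hq]

theorem renyiDiv_eq (hα0 : α ≠ 0) (hα1 : α ≠ 1) (hp : ∀ x, 0 ≤ p x) (hq : ∀ x, 0 ≤ q x)
    (h : ∀ x, RenyiFinite α (p x) (q x)) :
    renyiDiv α p q = ((1 / (α * (α - 1)) : ℝ) : EReal) *
      elog (∑ x, p x ^ α * q x ^ (1 - α)) := by
  rcases lt_or_gt_of_ne hα0 with hneg | hpos
  · rw [renyiDiv, if_neg hneg.not_gt, renyiPos_eq (sub_ne_zero.2 hα1.symm) (by simpa using hα0)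
      hq hp fun _ x => (h x).2 hneg]
    simp only [sub_sub_cancel, mul_comm (q _ ^ (1 - α))]
    rw [show (1 - α) * (1 - α - 1) = α * (α - 1) by ring]
  · rw [renyiDiv, if_pos hpos, renyiPos_eq hα0 hα1 hp hq fun hα x => (h x).1 hα]

theorem renyiDiv_eq_top {x : X} (h : ¬ RenyiFinite α (p x) (q x)) : renyiDiv α p q = ⊤ := by
  rcases lt_or_ge 1 α with hα | hα
  · have hx : ¬ (q x = 0 → p x = 0) := fun h' => h ⟨fun _ => h', fun h0 => by linarith⟩
    rw [renyiDiv, if_pos (by linarith), renyiPos, if_pos ⟨hα, fun h' => hx (h' x)⟩]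
  · obtain ⟨hα0, hx⟩ : α < 0 ∧ ¬ (p x = 0 → q x = 0) := by
      simpa [RenyiFinite, hα.not_gt] using h
    rw [renyiDiv, if_neg hα0.not_gt, renyiPos,
      if_pos ⟨by linarith, fun h' => hx (h' x)⟩]

theorem renyiDiv_one_sub (hα0 : α ≠ 0) (hα1 : α ≠ 1) (hp : ∀ x, 0 ≤ p x) (hq : ∀ x, 0 ≤ q x) :
    renyiDiv (1 - α) q p = renyiDiv α p q := by
  by_cases h : ∀ x, RenyiFinite α (p x) (q x)
  · rw [renyiDiv_eq hα0 hα1 hp hq h, renyiDiv_eq (sub_ne_zero.2 hα1.symm) (by simpa using hα0) hq hp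
      fun x => renyiFinite_one_sub_iff.2 (h x)]
    simp only [sub_sub_cancel, mul_comm (q _ ^ (1 - α))]
    rw [show (1 - α) * (1 - α - 1) = α * (α - 1) by ring]
  · obtain ⟨x, hx⟩ := not_forall.1 h
    rw [renyiDiv_eq_top hx, renyiDiv_eq_top (mt renyiFinite_one_sub_iff.1 hx)]

end RenyiDivergence

section ChainLaw

variable {d : ℕ} {α : ℝ} {ν θ : Matrix (Fin d) (Fin d) ℝ}

theorem chainLaw_succ (hν : ν ∈ MarkovDist d) (n : ℕ) (x : Fin (n + 1) → Fin d) :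
    chainLaw ν (n + 1) x =
      (∑ k, ν (x 0) k) * ∏ k : Fin n, condProb ν (x k.castSucc) (x k.succ) := by
  cases n with
  | zero => simp [chainLaw]
  | succ n =>
    rw [Fin.prod_univ_succ, ← mul_assoc, Fin.castSucc_zero, rowSum_mul_condProb hν]
    rfl

theorem chainLaw_nonneg (hν : ν ∈ MarkovDist d) (n : ℕ) (x : Fin n → Fin d) :
    0 ≤ chainLaw ν n x := by
  cases n with
  | zero => exact zero_le_one
  | succ n =>
    rw [chainLaw_succ hν]
    exact mul_nonneg (rowSum_nonneg hν _) (Finset.prod_nonneg fun k _ => condProb_nonneg hν _ _)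

theorem chainLaw_succ_pos_iff (hν : ν ∈ MarkovDist d) {n : ℕ} {x : Fin (n + 1) → Fin d} :
    0 < chainLaw ν (n + 1) x ↔
      0 < ∑ k, ν (x 0) k ∧ ∀ k : Fin n, 0 < ν (x k.castSucc) (x k.succ) := by
  rw [(chainLaw_nonneg hν _ x).lt_iff_ne', chainLaw_succ hν, mul_ne_zero_iff,
    Finset.prod_ne_zero_iff, (rowSum_nonneg hν _).lt_iff_ne']
  simp only [Finset.mem_univ, forall_const, ne_eq, condProb_eq_zero_iff hν,
    fun i j => (hν.1 i j).lt_iff_ne']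

theorem chainLaw_eq_zero (hν : ν ∈ MarkovDist d) (hθ : θ ∈ MarkovDist d)
    (h : ∀ i j, θ i j = 0 → ν i j = 0) (n : ℕ) (x : Fin n → Fin d) (hx : chainLaw θ n x = 0) :
    chainLaw ν n x = 0 := by
  have hpos : ∀ i j, 0 < ν i j → 0 < θ i j := fun i j hij =>
    (hθ.1 i j).lt_of_ne' fun h0 => hij.ne' (h i j h0)
  cases n with
  | zero => exact absurd hx one_ne_zero
  | succ n =>
    refine (chainLaw_nonneg hν _ x).eq_of_not_lt' fun hνx => hx.not_gt ?_
    obtain ⟨h0, hsteps⟩ := (chainLaw_succ_pos_iff hν).1 hνx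
    obtain ⟨j, hj⟩ := exists_pos_of_rowSum_pos h0
    exact (chainLaw_succ_pos_iff hθ).2
      ⟨rowSum_pos_of_pos hθ (hpos _ _ hj), fun k => hpos _ _ (hsteps k)⟩

theorem exists_chainLaw_pos (hν : ν ∈ MarkovDist d) {i j : Fin d} (hij : 0 < ν i j) (n : ℕ) :
    ∃ x : Fin (n + 2) → Fin d, x 0 = i ∧ x 1 = j ∧ 0 < chainLaw ν (n + 2) x := by
  have hsucc : ∀ a, ∃ b, 0 < ∑ k, ν a k → 0 < ν a b ∧ (a = i → b = j) := fun a => by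
    by_cases hai : a = i
    · exact ⟨j, fun _ => ⟨hai ▸ hij, fun _ => rfl⟩⟩
    by_cases ha : 0 < ∑ k, ν a k
    · exact (exists_pos_of_rowSum_pos ha).imp fun b hb _ => ⟨hb, fun h => absurd h hai⟩
    · exact ⟨j, fun h => absurd h ha⟩
  choose f hf using hsucc
  have hi := rowSum_pos_of_pos hν hij
  have hrow : ∀ k : ℕ, 0 < ∑ l, ν (f^[k] i) l := fun k => by
    induction k with
    | zero => exact hi
    | succ k ih => rw [Function.iterate_succ_apply']; exact rowSum_pos_of_pos' hν (hf _ ih).1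
  refine ⟨fun k => f^[k] i, rfl, (hf i hi).2 rfl, (chainLaw_succ_pos_iff hν).2 ⟨hi, fun k => ?_⟩⟩
  simp only [Fin.val_castSucc, Fin.val_succ, Function.iterate_succ_apply']
  exact (hf _ (hrow k)).1

theorem renyiFinite_chainLaw (hν : ν ∈ MarkovDist d) (hθ : θ ∈ MarkovDist d)
    (h : ∀ i j, RenyiFinite α (ν i j) (θ i j)) (n : ℕ) (x : Fin n → Fin d) :
    RenyiFinite α (chainLaw ν n x) (chainLaw θ n x) :=
  ⟨fun hα => chainLaw_eq_zero hν hθ (fun i j => (h i j).1 hα) n x,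
    fun hα => chainLaw_eq_zero hθ hν (fun i j => (h i j).2 hα) n x⟩

theorem exists_not_renyiFinite_chainLaw (hν : ν ∈ MarkovDist d) (hθ : θ ∈ MarkovDist d)
    {i j : Fin d} (h : ¬ RenyiFinite α (ν i j) (θ i j)) (n : ℕ) :
    ∃ x, ¬ RenyiFinite α (chainLaw ν (n + 2) x) (chainLaw θ (n + 2) x) := by
  have hpath : ∀ {ν θ : Matrix (Fin d) (Fin d) ℝ}, ν ∈ MarkovDist d → θ i j = 0 → ν i j ≠ 0 →
      ∃ x, chainLaw θ (n + 2) x = 0 ∧ chainLaw ν (n + 2) x ≠ 0 := fun hν hθ hij => by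
    obtain ⟨x, rfl, rfl, hx⟩ := exists_chainLaw_pos hν ((hν.1 i j).lt_of_ne' hij) n
    exact ⟨x, mul_eq_zero_of_left hθ _, hx.ne'⟩
  simp only [RenyiFinite, not_and_or, Classical.not_imp] at h ⊢
  rcases h with ⟨hα, h0, hij⟩ | ⟨hα, h0, hij⟩
  · exact (hpath hν h0 hij).imp fun x hx => .inl ⟨hα, hx⟩
  · exact (hpath hθ h0 hij).imp fun x hx => .inr ⟨hα, hx⟩

theorem sum_mul_prod_path {R ι : Type*} [CommSemiring R] [Fintype ι] [DecidableEq ι]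
    (a : ι → R) (C : Matrix ι ι R) (n : ℕ) :
    ∑ x : Fin (n + 1) → ι, a (x 0) * ∏ k : Fin n, C (x k.castSucc) (x k.succ) =
      ∑ i, a i * ∑ j, (C ^ n) i j := by
  induction n generalizing a with
  | zero =>
    rw [← (Equiv.funUnique (Fin 1) ι).symm.sum_comp]
    simp [Matrix.one_apply]
  | succ n ih =>
    rw [← (Fin.consEquiv fun _ => ι).sum_comp, Fintype.sum_prod_type]
    refine Finset.sum_congr rfl fun i _ => ?_
    simp only [Fin.consEquiv, Equiv.coe_fn_mk, Fin.cons_zero, Fin.prod_univ_succ, Fin.castSucc_zero,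
      Fin.cons_succ, ← Fin.succ_castSucc]
    rw [← Finset.mul_sum, ih fun j => C i j, pow_succ']
    simp_rw [Matrix.mul_apply, Finset.mul_sum]
    rw [Finset.sum_comm]

theorem sum_chainLaw_rpow (α : ℝ) (hν : ν ∈ MarkovDist d) (hθ : θ ∈ MarkovDist d) (n : ℕ) :
    ∑ x, chainLaw ν (n + 1) x ^ α * chainLaw θ (n + 1) x ^ (1 - α) =
      ∑ i, ((∑ k, ν i k) ^ α * (∑ k, θ i k) ^ (1 - α)) *
        ∑ j, (geomMean α (transMatrix ν) (transMatrix θ) ^ n) i j := by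
  rw [← sum_mul_prod_path]
  refine Finset.sum_congr rfl fun x _ => ?_
  rw [chainLaw_succ hν, chainLaw_succ hθ,
    Real.mul_rpow (rowSum_nonneg hν _) (Finset.prod_nonneg fun k _ => condProb_nonneg hν _ _),
    Real.mul_rpow (rowSum_nonneg hθ _) (Finset.prod_nonneg fun k _ => condProb_nonneg hθ _ _),
    ← Real.finsetProd_rpow _ _ (fun k _ => condProb_nonneg hν _ _),
    ← Real.finsetProd_rpow _ _ (fun k _ => condProb_nonneg hθ _ _), mul_mul_mul_comm,
    ← Finset.prod_mul_distrib]
  rfl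

theorem exists_weighted_rowSum_bounds {ι : Type*} [Fintype ι] [DecidableEq ι] {C : Matrix ι ι ℝ}
    (hC : ∀ i j, 0 ≤ C i j) {a : ι → ℝ} (ha : ∀ i, 0 ≤ a i) (h : ∀ i, a i = 0 → ∀ j, C i j = 0) :
    ∃ b > 0, ∃ b' > 0, ∀ n > 0, b * entrySum (C ^ n) ≤ ∑ i, a i * ∑ j, (C ^ n) i j ∧
      ∑ i, a i * ∑ j, (C ^ n) i j ≤ b' * entrySum (C ^ n) := by
  obtain ⟨b, hb, hab⟩ := exists_pos_forall_eq_zero_or_le ha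
  obtain ⟨b', hb'⟩ := Finite.exists_le a
  have hrow : ∀ n i, 0 ≤ ∑ j, (C ^ n) i j := fun n i =>
    Finset.sum_nonneg fun j _ => Matrix.pow_apply_nonneg hC n i j
  refine ⟨b, hb, max b' 1, by positivity, fun n hn => ⟨?_, ?_⟩⟩ <;>
    rw [entrySum, Finset.mul_sum] <;> refine Finset.sum_le_sum fun i _ => ?_
  · rcases hab i with h0 | hle
    · have : ∀ j, (C ^ n) i j = 0 := fun j => by
        rw [← Nat.succ_pred_eq_of_pos hn, pow_succ', Matrix.mul_apply]
        exact Finset.sum_eq_zero fun k _ => by rw [h i h0, zero_mul]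
      simp [this]
    · exact mul_le_mul_of_nonneg_right hle (hrow n i)
  · exact mul_le_mul_of_nonneg_right ((hb' i).trans (le_max_left _ _)) (hrow n i)

theorem tendsto_log_div_of_entrySum_bounds {ι : Type*} [Fintype ι] [DecidableEq ι]
    {C : Matrix ι ι ℝ} (hC : ∀ i j, 0 ≤ C i j) (hC' : ¬ IsNilpotent C) {T : ℕ → ℝ} {b b' : ℝ}
    (hb : 0 < b) (hb' : 0 < b')
    (hT : ∀ n > 0, b * entrySum (C ^ n) ≤ T n ∧ T n ≤ b' * entrySum (C ^ n)) :
    Tendsto (fun n : ℕ => Real.log (T n) / (n + 1)) atTop (𝓝 (growthExp C)) := by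
  have hpos := entrySum_pow_pos hC hC'
  have hlow : ∀ᶠ n : ℕ in atTop,
      Real.log b ≤ Real.log (T n) - Real.log (entrySum (C ^ n)) := by
    filter_upwards [eventually_gt_atTop 0] with n hn
    have := Real.log_le_log (mul_pos hb (hpos n)) (hT n hn).1
    rw [Real.log_mul hb.ne' (hpos n).ne'] at this
    linarith
  have hupp : ∀ᶠ n : ℕ in atTop,
      Real.log (T n) - Real.log (entrySum (C ^ n)) ≤ Real.log b' := by
    filter_upwards [eventually_gt_atTop 0] with n hn
    have := Real.log_le_log ((mul_pos hb (hpos n)).trans_le (hT n hn).1) (hT n hn).2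
    rw [Real.log_mul hb'.ne' (hpos n).ne'] at this
    linarith
  have hdiff := tendsto_bdd_div_atTop_nhds_zero hlow hupp
    (tendsto_natCast_atTop_atTop.atTop_add (tendsto_const_nhds (x := (1 : ℝ))))
  have hlim := ((tendsto_growthExp hC hC').mul (tendsto_natCast_div_add_atTop (1 : ℝ))).add hdiff
  rw [mul_one, add_zero] at hlim
  refine hlim.congr' ?_
  filter_upwards [eventually_gt_atTop 0] with n hn
  have hn' : (n : ℝ) ≠ 0 := by positivity
  field_simp
  ring

theorem renyiSeq_one_sub (hα0 : α ≠ 0) (hα1 : α ≠ 1) (hν : ν ∈ MarkovDist d)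
    (hθ : θ ∈ MarkovDist d) : renyiSeq (1 - α) θ ν = renyiSeq α ν θ := by
  funext n
  rw [renyiSeq, renyiSeq, renyiDiv_one_sub hα0 hα1 (chainLaw_nonneg hν n) (chainLaw_nonneg hθ n)]

theorem tendsto_renyiSeq_of_not_renyiFinite (hν : ν ∈ MarkovDist d) (hθ : θ ∈ MarkovDist d)
    {i j : Fin d} (h : ¬ RenyiFinite α (ν i j) (θ i j)) :
    Tendsto (renyiSeq α ν θ) atTop (𝓝 ⊤) := by
  refine (tendsto_add_atTop_iff_nat 2).1 (tendsto_const_nhds.congr fun n => ?_)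
  obtain ⟨x, hx⟩ := exists_not_renyiFinite_chainLaw hν hθ h n
  rw [renyiSeq, renyiDiv_eq_top hx, EReal.coe_mul_top_of_pos (by positivity)]

variable (hα0 : α ≠ 0) (hα1 : α ≠ 1) (hν : ν ∈ MarkovDist d) (hθ : θ ∈ MarkovDist d)
  (h : ∀ i j, RenyiFinite α (ν i j) (θ i j))
include hα0 hα1 hν hθ h

theorem renyiSeq_succ (n : ℕ) :
    renyiSeq α ν θ (n + 1) = ((1 / ((n + 1 : ℕ) : ℝ) : ℝ) : EReal) *
      (((1 / (α * (α - 1)) : ℝ) : EReal) *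
        elog (∑ i, ((∑ k, ν i k) ^ α * (∑ k, θ i k) ^ (1 - α)) *
          ∑ j, (geomMean α (transMatrix ν) (transMatrix θ) ^ n) i j)) := by
  rw [renyiSeq, renyiDiv_eq hα0 hα1 (chainLaw_nonneg hν _) (chainLaw_nonneg hθ _)
    (renyiFinite_chainLaw hν hθ h _), sum_chainLaw_rpow α hν hθ]

theorem tendsto_renyiSeq (hC : ¬ IsNilpotent (geomMean α (transMatrix ν) (transMatrix θ))) :
    Tendsto (renyiSeq α ν θ) atTop (𝓝
      ((growthExp (geomMean α (transMatrix ν) (transMatrix θ)) / (α * (α - 1)) : ℝ) : EReal)) := by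
  set C := geomMean α (transMatrix ν) (transMatrix θ) with hCdef
  have hnn : ∀ i j, 0 ≤ C i j := geomMean_nonneg (condProb_nonneg hν) (condProb_nonneg hθ)
  have hzero : ∀ i, (∑ k, ν i k) ^ α * (∑ k, θ i k) ^ (1 - α) = 0 → ∀ j, C i j = 0 := by
    intro i hi j
    have hα1' : 1 - α ≠ 0 := sub_ne_zero.2 hα1.symm
    rw [hCdef, geomMean_apply]
    rcases mul_eq_zero.1 hi with hi | hi
    · simp [condProb, (Real.rpow_eq_zero (rowSum_nonneg hν i) hα0).1 hi, hα0]
    · simp [condProb, (Real.rpow_eq_zero (rowSum_nonneg hθ i) hα1').1 hi, hα1']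
  obtain ⟨b, hb, b', hb', hbounds⟩ := exists_weighted_rowSum_bounds hnn (fun i => mul_nonneg
    (Real.rpow_nonneg (rowSum_nonneg hν i) α) (Real.rpow_nonneg (rowSum_nonneg hθ i) (1 - α))) hzero
  have hlim := tendsto_log_div_of_entrySum_bounds hnn hC hb hb' hbounds
  refine (tendsto_add_atTop_iff_nat 1).1
    ((EReal.tendsto_coe.2 (hlim.div_const (α * (α - 1)))).congr' ?_)
  filter_upwards [eventually_gt_atTop 0] with n hn
  rw [renyiSeq_succ hα0 hα1 hν hθ h, elog_of_pos ((mul_pos hb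
    (entrySum_pow_pos hnn hC n)).trans_le (hbounds n hn).1), ← EReal.coe_mul, ← EReal.coe_mul]
  congr 1
  push_cast
  ring

theorem tendsto_renyiSeq_top (hC : IsNilpotent (geomMean α (transMatrix ν) (transMatrix θ))) :
    Tendsto (renyiSeq α ν θ) atTop (𝓝 ⊤) := by
  have hlt : α * (α - 1) < 0 := by
    have habs : ∀ {μ η : Matrix (Fin d) (Fin d) ℝ} {β : ℝ},
        μ ∈ MarkovDist d → η ∈ MarkovDist d → (∀ i j, η i j = 0 → μ i j = 0) →
          ¬ IsNilpotent (geomMean β (transMatrix μ) (transMatrix η)) :=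
      fun hμ hη hμη => not_isNilpotent_geomMean (condProb_nonneg hμ) (condProb_nonneg hη)
        (not_isNilpotent_transMatrix hμ) fun i j hij => (condProb_pos_iff hη).2
          ((hη.1 i j).lt_of_ne' (mt (hμη i j) ((condProb_pos_iff hμ).1 hij).ne'))
    rcases lt_or_gt_of_ne hα0 with hα0 | hα0
    · rw [← geomMean_one_sub] at hC
      exact absurd hC (habs hθ hν fun i j => (h i j).2 hα0)
    rcases lt_or_gt_of_ne hα1 with hα1 | hα1
    · exact mul_neg_of_pos_of_neg hα0 (sub_neg.2 hα1)
    · exact absurd hC (habs hν hθ fun i j => (h i j).1 hα1)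
  obtain ⟨m, hm⟩ := hC
  refine (tendsto_add_atTop_iff_nat 1).1 (tendsto_const_nhds.congr' ?_)
  filter_upwards [eventually_ge_atTop m] with n hn
  simp only [renyiSeq_succ hα0 hα1 hν hθ h, pow_eq_zero_of_le hn hm, Matrix.zero_apply,
    Finset.sum_const_zero, mul_zero, elog_zero]
  rw [EReal.coe_mul_bot_of_neg (one_div_neg.2 hlt), EReal.coe_mul_top_of_pos (by positivity)]

omit h

theorem tendsto_renyiSeq_cases :
    Tendsto (renyiSeq α ν θ) atTop (𝓝 ⊤) ∨
      (∀ i j, RenyiFinite α (ν i j) (θ i j)) ∧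
        ¬ IsNilpotent (geomMean α (transMatrix ν) (transMatrix θ)) ∧
        Tendsto (renyiSeq α ν θ) atTop (𝓝
          ((growthExp (geomMean α (transMatrix ν) (transMatrix θ)) / (α * (α - 1)) : ℝ) :
            EReal)) := by
  by_cases h : ∀ i j, RenyiFinite α (ν i j) (θ i j)
  · by_cases hC : IsNilpotent (geomMean α (transMatrix ν) (transMatrix θ))
    · exact .inl (tendsto_renyiSeq_top hα0 hα1 hν hθ h hC)
    · exact .inr ⟨h, hC, tendsto_renyiSeq hα0 hα1 hν hθ h hC⟩
  · push Not at h
    obtain ⟨i, j, hij⟩ := h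
    exact .inl (tendsto_renyiSeq_of_not_renyiFinite hν hθ hij)

theorem exists_tendsto_renyiSeq : ∃ l : EReal, Tendsto (renyiSeq α ν θ) atTop (𝓝 l) :=
  (tendsto_renyiSeq_cases hα0 hα1 hν hθ).elim (fun h => ⟨_, h⟩) fun h => ⟨_, h.2.2⟩

end ChainLaw

section Perron

open Matrix

variable {ι : Type*} [Fintype ι] {A B : Matrix ι ι ℝ} {x : ι → ℝ} {l : ℝ}

/-- The numbers `l` such that `l x ≤ A x` for some nonzero `x ≥ 0`; for `A ≥ 0` the largest one is
the Collatz–Wielandt expression for the spectral radius. -/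
def subeigenvalues (A : Matrix ι ι ℝ) : Set ℝ :=
  {l | ∃ x, 0 ≤ x ∧ x ≠ 0 ∧ l • x ≤ A *ᵥ x}

theorem mulVec_apply_pos (hB : ∀ i j, 0 < B i j) (hx : 0 ≤ x) (hx0 : x ≠ 0) (i : ι) :
    0 < (B *ᵥ x) i := by
  obtain ⟨j, hj⟩ := Function.ne_iff.1 hx0
  exact Finset.sum_pos' (fun k _ => mul_nonneg (hB i k).le (hx k))
    ⟨j, Finset.mem_univ j, mul_pos (hB i j) ((hx j).lt_of_ne' hj)⟩

theorem exists_mem_stdSimplex_of_mem_subeigenvalues (hl : l ∈ subeigenvalues A) :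
    ∃ x ∈ stdSimplex ℝ ι, l • x ≤ A *ᵥ x := by
  obtain ⟨x, hx, hx0, hle⟩ := hl
  have hs : 0 < ∑ i, x i := by
    obtain ⟨i, hi⟩ := Function.ne_iff.1 hx0
    exact Finset.sum_pos' (fun j _ => hx j) ⟨i, Finset.mem_univ i, (hx i).lt_of_ne' hi⟩
  refine ⟨(∑ i, x i)⁻¹ • x, ⟨fun i => mul_nonneg (inv_nonneg.2 hs.le) (hx i), ?_⟩, ?_⟩
  · simp only [Pi.smul_apply, smul_eq_mul, ← Finset.mul_sum, inv_mul_cancel₀ hs.ne']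
  · rw [mulVec_smul, smul_comm]
    exact smul_le_smul_of_nonneg_left hle (inv_nonneg.2 hs.le)

theorem le_entrySum_of_smul_le_mulVec (hA : ∀ i j, 0 ≤ A i j) (hx : x ∈ stdSimplex ℝ ι)
    (hle : l • x ≤ A *ᵥ x) : l ≤ entrySum A :=
  calc l = ∑ i, (l • x) i := by
        simp only [Pi.smul_apply, smul_eq_mul, ← Finset.mul_sum, hx.2, mul_one]
    _ ≤ ∑ i, (A *ᵥ x) i := Finset.sum_le_sum fun i _ => hle i
    _ ≤ entrySum A := Finset.sum_le_sum fun i _ => Finset.sum_le_sum fun j _ =>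
        mul_le_of_le_one_right (hA i j) (by
          rw [← hx.2]
          exact Finset.single_le_sum (fun k _ => hx.1 k) (Finset.mem_univ j))

theorem exists_isGreatest_subeigenvalues [Nonempty ι] (hA : ∀ i j, 0 ≤ A i j) :
    ∃ l, 0 ≤ l ∧ IsGreatest (subeigenvalues A) l := by
  let K : Set ((ι → ℝ) × ℝ) :=
    (stdSimplex ℝ ι ×ˢ Set.Icc 0 (entrySum A)) ∩ {p | p.2 • p.1 ≤ A *ᵥ p.1}
  have hK : IsCompact K := ((isCompact_stdSimplex ℝ ι).prod isCompact_Icc).inter_right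
    (isClosed_le (by fun_prop) (by fun_prop))
  have hmem : ∀ l ∈ subeigenvalues A, 0 ≤ l → ∃ x, (x, l) ∈ K := fun l hl hl0 => by
    obtain ⟨x, hx, hle⟩ := exists_mem_stdSimplex_of_mem_subeigenvalues hl
    exact ⟨x, ⟨hx, hl0, le_entrySum_of_smul_le_mulVec hA hx hle⟩, hle⟩
  have hzero : (0 : ℝ) ∈ subeigenvalues A := ⟨1, zero_le_one, one_ne_zero, fun i => by
    simpa [mulVec, dotProduct] using Finset.sum_nonneg fun j _ => hA i j⟩
  obtain ⟨x₀, hx₀⟩ := hmem 0 hzero le_rfl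
  obtain ⟨⟨x, l⟩, ⟨⟨hx, hl0, -⟩, hle⟩, hmax⟩ :=
    hK.exists_isMaxOn ⟨_, hx₀⟩ continuous_snd.continuousOn
  refine ⟨l, hl0, ⟨x, hx.1, ?_, hle⟩, fun l' hl' => ?_⟩
  · rintro rfl
    simpa using hx.2
  · rcases le_total l' 0 with h | h
    · exact h.trans hl0
    · obtain ⟨x', hx'⟩ := hmem l' hl' h
      exact hmax hx'

theorem exists_gt_mem_subeigenvalues [Nonempty ι] (hB : ∀ i j, 0 < B i j) (hAB : Commute A B)
    (hx : 0 ≤ x) (hle : l • x ≤ A *ᵥ x) (hne : A *ᵥ x ≠ l • x) :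
    ∃ l' > l, l' ∈ subeigenvalues A := by
  have hx0 : x ≠ 0 := by
    rintro rfl
    simp at hne
  have hBx := mulVec_apply_pos hB hx hx0
  have hBy := mulVec_apply_pos hB (sub_nonneg.2 hle) (sub_ne_zero.2 hne)
  have hABx : A *ᵥ (B *ᵥ x) = l • B *ᵥ x + B *ᵥ (A *ᵥ x - l • x) := by
    rw [mulVec_mulVec, hAB.eq, ← mulVec_mulVec, mulVec_sub, mulVec_smul, add_sub_cancel]
  obtain ⟨i₀, hi₀⟩ := Finite.exists_min fun i => (B *ᵥ (A *ᵥ x - l • x)) i / (B *ᵥ x) i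
  refine ⟨_, lt_add_of_pos_right l (div_pos (hBy i₀) (hBx i₀)), B *ᵥ x, fun i => (hBx i).le,
    fun h => (hBx i₀).ne' (congrFun h i₀), ?_⟩
  rw [hABx, add_smul, add_le_add_iff_left]
  exact fun i => (le_div_iff₀ (hBx i)).1 (hi₀ i)

theorem exists_commute_forall_pos_of_isIrreducible (hA : A.IsIrreducible) :
    ∃ B, (∀ i j, 0 < B i j) ∧ Commute A B := by
  classical
  choose k _ hpos using (isIrreducible_iff_exists_pow_pos hA.nonneg).1 hA
  refine ⟨∑ i, ∑ j, A ^ k i j, fun a b => ?_,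
    .sum_right _ _ _ fun i _ => .sum_right _ _ _ fun j _ => Commute.self_pow A _⟩
  have hnonneg : ∀ i j, 0 ≤ (A ^ k i j) a b := fun i j => pow_apply_nonneg hA.nonneg _ a b
  simp only [Matrix.sum_apply]
  exact Finset.sum_pos' (fun i _ => Finset.sum_nonneg fun j _ => hnonneg i j)
    ⟨a, Finset.mem_univ a, Finset.sum_pos' (fun j _ => hnonneg a j)
      ⟨b, Finset.mem_univ b, hpos a b⟩⟩

theorem exists_pos_eigenvector_of_isIrreducible [Nonempty ι] (hA : A.IsIrreducible) :
    ∃ (w : ι → ℝ) (κ : ℝ), (∀ i, 0 < w i) ∧ 0 < κ ∧ A *ᵥ w = κ • w := by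
  classical
  obtain ⟨B, hB, hAB⟩ := exists_commute_forall_pos_of_isIrreducible hA
  obtain ⟨κ, hκ, ⟨x, hx, hx0, hle⟩, hmax⟩ := exists_isGreatest_subeigenvalues hA.nonneg
  have hAx : A *ᵥ x = κ • x := by
    by_contra hne
    obtain ⟨l, hlt, hl⟩ := exists_gt_mem_subeigenvalues hB hAB hx hle hne
    exact hlt.not_ge (hmax hl)
  have hABx : A *ᵥ (B *ᵥ x) = κ • B *ᵥ x := by
    rw [mulVec_mulVec, hAB.eq, ← mulVec_mulVec, hAx, mulVec_smul]
  have hpos := mulVec_apply_pos hB hx hx0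
  refine ⟨B *ᵥ x, κ, hpos, hκ.lt_of_ne' ?_, hABx⟩
  rintro rfl
  let i : ι := Classical.arbitrary ι
  obtain ⟨k, hk, hkpos⟩ := (isIrreducible_iff_exists_pow_pos hA.nonneg).1 hA i i
  have hzero : A ^ k *ᵥ (B *ᵥ x) = 0 := by
    rw [← Nat.succ_pred_eq_of_pos hk, pow_succ, ← mulVec_mulVec, hABx, zero_smul, mulVec_zero]
  have hlt : 0 < (A ^ k *ᵥ (B *ᵥ x)) i :=
    Finset.sum_pos' (fun j _ => mul_nonneg (pow_apply_nonneg hA.nonneg k i j) (hpos j).le)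
      ⟨i, Finset.mem_univ i, mul_pos hkpos (hpos i)⟩
  exact hlt.ne' (congrFun hzero i)

theorem exists_pos_eigenvectors_of_isIrreducible [Nonempty ι] (hA : A.IsIrreducible) :
    ∃ (u w : ι → ℝ) (κ : ℝ), (∀ i, 0 < u i) ∧ (∀ i, 0 < w i) ∧ 0 < κ ∧
      u ᵥ* A = κ • u ∧ A *ᵥ w = κ • w := by
  obtain ⟨w, κ, hw, hκ, hAw⟩ := exists_pos_eigenvector_of_isIrreducible hA
  obtain ⟨u, κ', hu, -, hAu⟩ := exists_pos_eigenvector_of_isIrreducible hA.transpose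
  rw [mulVec_transpose] at hAu
  have huw : 0 < u ⬝ᵥ w :=
    Finset.sum_pos (fun i _ => mul_pos (hu i) (hw i)) Finset.univ_nonempty
  have heq : κ * (u ⬝ᵥ w) = κ' * (u ⬝ᵥ w) := by
    simpa only [hAw, hAu, dotProduct_smul, smul_dotProduct, smul_eq_mul] using
      dotProduct_mulVec u A w
  obtain rfl := mul_right_cancel₀ huw.ne' heq
  exact ⟨u, w, κ, hu, hw, hκ, hAu, hAw⟩

theorem exists_stationary_diagConj [Nonempty ι] (hA : A.IsIrreducible) :
    ∃ c > 0, ∃ w p : ι → ℝ, (∀ i, 0 < w i) ∧ (∀ i, 0 < p i) ∧ ∑ i, p i = 1 ∧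
      (∀ i, ∑ j, diagConj c w A i j = 1) ∧ ∀ j, ∑ i, p i * diagConj c w A i j = p j := by
  obtain ⟨u, w, κ, hu, hw, hκ, hAu, hAw⟩ := exists_pos_eigenvectors_of_isIrreducible hA
  have huw : 0 < u ⬝ᵥ w :=
    Finset.sum_pos (fun i _ => mul_pos (hu i) (hw i)) Finset.univ_nonempty
  refine ⟨κ⁻¹, inv_pos.2 hκ, w, fun i => u i * w i / (u ⬝ᵥ w), hw,
    fun i => div_pos (mul_pos (hu i) (hw i)) huw, ?_, fun i => ?_, fun j => ?_⟩
  · rw [← Finset.sum_div]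
    exact div_self huw.ne'
  · have hi := (hw i).ne'
    calc ∑ j, diagConj κ⁻¹ w A i j = κ⁻¹ * ((A *ᵥ w) i / w i) := by
          simp only [diagConj_apply, mulVec, dotProduct, Finset.sum_div, Finset.mul_sum,
            mul_div_assoc]
      _ = 1 := by
          rw [hAw, Pi.smul_apply, smul_eq_mul]
          field_simp
  · calc ∑ i, u i * w i / (u ⬝ᵥ w) * diagConj κ⁻¹ w A i j
        = (u ᵥ* A) j * (κ⁻¹ * w j / (u ⬝ᵥ w)) := by
          simp only [diagConj_apply, vecMul, dotProduct, Finset.sum_mul]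
          refine Finset.sum_congr rfl fun i _ => ?_
          have hi := (hw i).ne'
          field_simp
      _ = u j * w j / (u ⬝ᵥ w) := by
          rw [hAu, Pi.smul_apply, smul_eq_mul]
          field_simp

end Perron

theorem sum_eq_sum_coe_of_forall_notMem {ι R : Type*} [Fintype ι] [AddCommMonoid R] (f : ι → R)
    (C : Set ι) [Fintype C] (hf : ∀ i ∉ C, f i = 0) : ∑ i, f i = ∑ a : C, f a :=
  (Fintype.sum_of_injective _ Subtype.val_injective _ f (by simpa using hf) fun _ => rfl).symm

theorem isIrreducible_of_forall_pos {ι : Type*} [Finite ι] {M N : Matrix ι ι ℝ}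
    (hM : M.IsIrreducible) (hN : ∀ i j, 0 ≤ N i j) (h : ∀ i j, 0 < M i j → 0 < N i j) :
    N.IsIrreducible := by
  classical
  have := Fintype.ofFinite ι
  exact (Matrix.isIrreducible_iff_exists_pow_pos hN).2 fun i j =>
    ((Matrix.isIrreducible_iff_exists_pow_pos hM.nonneg).1 hM i j).imp fun k hk =>
      ⟨hk.1, pow_apply_pos_of_forall_pos hM.nonneg hN h k hk.2⟩

section RestrictRows

variable {ι : Type*} {M : Matrix ι ι ℝ} {C : Set ι} {i : ι}

/-- The matrix obtained from `M` by replacing the rows outside `C` by zero. -/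
noncomputable def restrictRows (C : Set ι) (M : Matrix ι ι ℝ) : Matrix ι ι ℝ :=
  Matrix.of (C.indicator M)

theorem restrictRows_apply_of_mem (hi : i ∈ C) (M : Matrix ι ι ℝ) (j : ι) :
    restrictRows C M i j = M i j :=
  congrFun (Set.indicator_of_mem hi M) j

theorem restrictRows_apply_of_notMem (hi : i ∉ C) (M : Matrix ι ι ℝ) (j : ι) :
    restrictRows C M i j = 0 :=
  congrFun (Set.indicator_of_notMem hi M) j

theorem restrictRows_nonneg (hM : ∀ i j, 0 ≤ M i j) (C : Set ι) (i j : ι) :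
    0 ≤ restrictRows C M i j := by
  by_cases hi : i ∈ C
  · exact (hM i j).trans_eq (restrictRows_apply_of_mem hi M j).symm
  · exact (restrictRows_apply_of_notMem hi M j).ge

theorem restrictRows_le (hM : ∀ i j, 0 ≤ M i j) (C : Set ι) (i j : ι) :
    restrictRows C M i j ≤ M i j := by
  by_cases hi : i ∈ C
  · exact (restrictRows_apply_of_mem hi M j).le
  · exact (restrictRows_apply_of_notMem hi M j).trans_le (hM i j)

variable [Fintype ι] [DecidableEq ι]

theorem restrictRows_pow_apply (hC : ∀ i ∈ C, ∀ j ∉ C, M i j = 0) (n : ℕ) (hi : i ∈ C) (j : ι) :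
    (restrictRows C M ^ n) i j = (M ^ n) i j := by
  induction n generalizing i with
  | zero => rfl
  | succ n ih =>
    rw [pow_succ', pow_succ', Matrix.mul_apply, Matrix.mul_apply]
    refine Finset.sum_congr rfl fun k _ => ?_
    rw [restrictRows_apply_of_mem hi]
    by_cases hk : k ∈ C
    · rw [ih hk]
    · rw [hC i hi k hk, zero_mul, zero_mul]

theorem submatrix_coe_pow_apply [Fintype C] (hC : ∀ i ∈ C, ∀ j ∉ C, M i j = 0) (n : ℕ) (a b : C) :
    ((M.submatrix (↑) (↑) : Matrix C C ℝ) ^ n) a b = (M ^ n) a b := by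
  induction n generalizing a with
  | zero => simp [Matrix.one_apply, Subtype.ext_iff]
  | succ n ih =>
    rw [pow_succ', pow_succ', Matrix.mul_apply, Matrix.mul_apply, sum_eq_sum_coe_of_forall_notMem
      _ C fun k hk => by rw [hC a a.2 k hk, zero_mul]]
    exact Finset.sum_congr rfl fun c _ => by rw [ih]; rfl

end RestrictRows

section EigenMarkov

variable {d : ℕ}

theorem exists_markovDist_transMatrix_eq {P : Matrix (Fin d) (Fin d) ℝ} {p : Fin d → ℝ}
    (hP : ∀ i j, 0 ≤ P i j) (hp : ∀ i, 0 ≤ p i) (hp1 : ∑ i, p i = 1)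
    (hrow : ∀ i, p i ≠ 0 → ∑ j, P i j = 1) (hrow0 : ∀ i, p i = 0 → ∀ j, P i j = 0)
    (hstat : ∀ j, ∑ i, p i * P i j = p j) : ∃ θ ∈ MarkovDist d, transMatrix θ = P := by
  have hsum : ∀ i, ∑ j, p i * P i j = p i := fun i => by
    rw [← Finset.mul_sum]
    by_cases hi : p i = 0
    · rw [hi, zero_mul]
    · rw [hrow i hi, mul_one]
  refine ⟨Matrix.of fun i j => p i * P i j, ⟨fun i j => mul_nonneg (hp i) (hP i j), ?_,
    fun k => (hsum k).trans (hstat k).symm⟩, ?_⟩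
  · simp only [Matrix.of_apply, hsum, hp1]
  · ext i j
    simp only [Matrix.of_apply, condProb, hsum]
    rcases (hp i).eq_or_lt with hi | hi
    · rw [if_neg hi.ge.not_gt, hrow0 i hi.symm]
    · rw [if_pos hi, mul_div_cancel_left₀ _ hi.ne']

theorem exists_markovDist_transMatrix_eq_of_subtype {P : Matrix (Fin d) (Fin d) ℝ}
    (hP : ∀ i j, 0 ≤ P i j) {C : Set (Fin d)} [Fintype C]
    (hC : ∀ i j, P i j ≠ 0 → i ∈ C ∧ j ∈ C) {p : C → ℝ} (hp : ∀ a, 0 < p a) (hp1 : ∑ a, p a = 1)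
    (hrow : ∀ a : C, ∑ b : C, P a b = 1) (hstat : ∀ b : C, ∑ a : C, p a * P a b = p b) :
    ∃ θ ∈ MarkovDist d, transMatrix θ = P := by
  classical
  let q : Fin d → ℝ := fun i => if h : i ∈ C then p ⟨i, h⟩ else 0
  have hqC : ∀ a : C, q a = p a := fun a => dif_pos a.2
  have hq0 : ∀ i ∉ C, q i = 0 := fun i hi => dif_neg hi
  have hP0 : ∀ i j, ¬ (i ∈ C ∧ j ∈ C) → P i j = 0 := fun i j => not_imp_comm.1 (hC i j)
  refine exists_markovDist_transMatrix_eq (p := q) hP (fun i => ?_) ?_ (fun i hi => ?_)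
    (fun i hi j => hP0 i j fun hij => ?_) fun j => ?_
  · by_cases h : i ∈ C
    · exact (hp ⟨i, h⟩).le.trans_eq (hqC ⟨i, h⟩).symm
    · exact (hq0 i h).ge
  · simp only [sum_eq_sum_coe_of_forall_notMem q C hq0, hqC, hp1]
  · have h : i ∈ C := not_imp_comm.1 (hq0 i) hi
    rw [sum_eq_sum_coe_of_forall_notMem _ C fun j hj => hP0 i j fun h => hj h.2]
    exact hrow ⟨i, h⟩
  · exact (hp ⟨i, hij.1⟩).ne' ((hqC ⟨i, hij.1⟩).symm.trans hi)
  · rw [sum_eq_sum_coe_of_forall_notMem _ C fun i hi => by rw [hq0 i hi, zero_mul]]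
    by_cases h : j ∈ C
    · simp only [hqC, hqC ⟨j, h⟩, hstat ⟨j, h⟩]
    · rw [hq0 j h]
      exact Finset.sum_eq_zero fun a _ => by rw [hP0 a j fun hij => h hij.2, mul_zero]

theorem exists_markovDist_transMatrix_eq_diagConj {N : Matrix (Fin d) (Fin d) ℝ}
    (hN : ∀ i j, 0 ≤ N i j) {C : Set (Fin d)} [Nonempty C]
    (hC : ∀ i j, N i j ≠ 0 → i ∈ C ∧ j ∈ C)
    (hirr : (N.submatrix (↑) (↑) : Matrix C C ℝ).IsIrreducible) :
    ∃ θ ∈ MarkovDist d, ∃ c > 0, ∃ w : Fin d → ℝ, (∀ i, 0 < w i) ∧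
      transMatrix θ = diagConj c w N := by
  classical
  obtain ⟨c, hc, w, p, hw, hp, hp1, hrow, hstat⟩ := exists_stationary_diagConj hirr
  let w' : Fin d → ℝ := fun i => if h : i ∈ C then w ⟨i, h⟩ else 1
  have hw' : ∀ i, 0 < w' i := fun i => by
    by_cases h : i ∈ C
    · simp only [w', dif_pos h, hw]
    · simp only [w', dif_neg h, one_pos]
  have hsub : ∀ a b : C, diagConj c w' N a b = diagConj c w (N.submatrix (↑) (↑)) a b :=
    fun a b => by simp [diagConj_apply, w']
  obtain ⟨θ, hθ, hθN⟩ := exists_markovDist_transMatrix_eq_of_subtype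
    (diagConj_nonneg hc hw' hN) (fun i j hij => hC i j fun h => hij (by simp [diagConj_apply, h]))
    hp hp1 (fun a => by simpa only [hsub] using hrow a) fun b => by simpa only [hsub] using hstat b
  exact ⟨θ, hθ, c, hc, w', hw', hθN⟩

theorem exists_expTilt_eq_diagConj (c : ℝ) (G : Matrix (Fin d) (Fin d) ℝ)
    {M : Matrix (Fin d) (Fin d) ℝ} (hM : ∀ i j, 0 ≤ M i j) {C : Set (Fin d)} [Nonempty C]
    (hC : ∀ i j, M i j ≠ 0 → i ∈ C ∧ j ∈ C)
    (hirr : (M.submatrix (↑) (↑) : Matrix C C ℝ).IsIrreducible) :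
    ∃ θ ∈ MarkovDist d, ∃ b > 0, ∃ w : Fin d → ℝ, (∀ i, 0 < w i) ∧
      expTilt c G θ = diagConj b w M := by
  classical
  let N : Matrix (Fin d) (Fin d) ℝ := Matrix.of fun i j => Real.exp (-(c * G i j)) * M i j
  have hN : ∀ i j, 0 ≤ N i j := fun i j => mul_nonneg (Real.exp_pos _).le (hM i j)
  obtain ⟨θ, hθ, b, hb, w, hw, hθN⟩ := exists_markovDist_transMatrix_eq_diagConj hN
    (fun i j h => hC i j (right_ne_zero_of_mul h))
    (isIrreducible_of_forall_pos hirr (fun a b => hN a b) fun a b => mul_pos (Real.exp_pos _))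
  refine ⟨θ, hθ, b, hb, w, hw, Matrix.ext fun i j => ?_⟩
  have hij : condProb θ i j = b * (Real.exp (-(c * G i j)) * M i j * (w j / w i)) :=
    congrFun₂ hθN i j
  simp only [expTilt, Matrix.of_apply, diagConj_apply, hij, Real.exp_neg]
  field_simp

end EigenMarkov

section Reachable

variable {ι : Type*} [Fintype ι] [DecidableEq ι] {M : Matrix ι ι ℝ} {i j k : ι}

/-- The states that can be reached from `i` in at least one step along positive entries of `M ≥ 0`;
`i` itself is one of them only if it lies on a cycle. -/
def reachable (M : Matrix ι ι ℝ) (i : ι) : Set ι :=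
  {j | ∃ n > 0, 0 < (M ^ n) i j}

theorem mem_reachable_of_apply_pos (h : 0 < M i j) : j ∈ reachable M i :=
  ⟨1, one_pos, by rwa [pow_one]⟩

theorem mem_reachable_trans (hM : ∀ i j, 0 ≤ M i j) (hij : j ∈ reachable M i)
    (hjk : k ∈ reachable M j) : k ∈ reachable M i := by
  obtain ⟨m, hm, hij⟩ := hij
  obtain ⟨n, -, hjk⟩ := hjk
  refine ⟨m + n, by omega, ?_⟩
  rw [pow_add]
  exact mul_apply_pos (Matrix.pow_apply_nonneg hM m) (Matrix.pow_apply_nonneg hM n) hij hjk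

theorem apply_eq_zero_of_mem_reachable (hM : ∀ i j, 0 ≤ M i j) :
    ∀ j ∈ reachable M i, ∀ k ∉ reachable M i, M j k = 0 := fun j hj k hk =>
  (hM j k).eq_of_not_lt' fun h => hk (mem_reachable_trans hM hj (mem_reachable_of_apply_pos h))

theorem isIrreducible_submatrix_reachable (hM : ∀ i j, 0 ≤ M i j)
    (hsymm : ∀ i j, j ∈ reachable M i → i ∈ reachable M j) (i : ι) :
    (M.submatrix (↑) (↑) : Matrix (reachable M i) (reachable M i) ℝ).IsIrreducible := by
  classical
  refine (Matrix.isIrreducible_iff_exists_pow_pos fun _ _ => ?_).2 fun a b => ?_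
  · exact hM _ _
  obtain ⟨n, hn, hab⟩ := mem_reachable_trans hM (hsymm i a a.2) b.2
  exact ⟨n, hn, by rwa [submatrix_coe_pow_apply (apply_eq_zero_of_mem_reachable hM)]⟩

theorem exists_frequently_entrySum_pow_le_restrictRows [Nonempty ι] (hM : ∀ i j, 0 ≤ M i j)
    (hM' : ¬ IsNilpotent M) (hsymm : ∀ i j, j ∈ reachable M i → i ∈ reachable M j) :
    ∃ i, i ∈ reachable M i ∧ ∃ᶠ n in atTop,
      entrySum (M ^ n) ≤ Fintype.card ι * entrySum (restrictRows (reachable M i) M ^ n) := by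
  have hrow : ∀ n > 0, ∃ i, i ∈ reachable M i ∧
      entrySum (M ^ n) ≤ Fintype.card ι * entrySum (restrictRows (reachable M i) M ^ n) := by
    intro n hn
    obtain ⟨i, hi⟩ := exists_entrySum_le_card_mul_rowSum (M ^ n)
    obtain ⟨j, hj⟩ : ∃ j, 0 < (M ^ n) i j := by
      by_contra! hle
      exact ((entrySum_pow_pos hM hM' n).trans_le hi).not_ge
        (mul_nonpos_of_nonneg_of_nonpos (Nat.cast_nonneg _) (Finset.sum_nonpos fun j _ => hle j))
    have hii : i ∈ reachable M i := mem_reachable_trans hM ⟨n, hn, hj⟩ (hsymm i j ⟨n, hn, hj⟩)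
    refine ⟨i, hii, hi.trans (mul_le_mul_of_nonneg_left ?_ (Nat.cast_nonneg _))⟩
    simp only [← restrictRows_pow_apply (apply_eq_zero_of_mem_reachable hM) n hii]
    exact Finset.single_le_sum (f := fun a => ∑ j, (restrictRows (reachable M i) M ^ n) a j)
      (fun a _ => Finset.sum_nonneg fun j _ =>
        Matrix.pow_apply_nonneg (restrictRows_nonneg hM _) n a j) (Finset.mem_univ i)
  obtain ⟨i, hi⟩ := frequently_exists.1 ((eventually_gt_atTop 0).mono hrow).frequently
  exact ⟨i, hi.exists.choose_spec.1, hi.mono fun n hn => hn.2⟩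

theorem exists_growthExp_le_restrictRows [Nonempty ι] (hM : ∀ i j, 0 ≤ M i j)
    (hM' : ¬ IsNilpotent M) (hsymm : ∀ i j, j ∈ reachable M i → i ∈ reachable M j) :
    ∃ i, i ∈ reachable M i ∧ ¬ IsNilpotent (restrictRows (reachable M i) M) ∧
      growthExp M ≤ growthExp (restrictRows (reachable M i) M) := by
  obtain ⟨i, hi, hfreq⟩ := exists_frequently_entrySum_pow_le_restrictRows hM hM' hsymm
  have hnil : ¬ IsNilpotent (restrictRows (reachable M i) M) := by
    rintro ⟨m, hm⟩
    obtain ⟨n, hle, hn⟩ := (hfreq.and_eventually (eventually_ge_atTop m)).exists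
    rw [pow_eq_zero_of_le hn hm] at hle
    simp only [entrySum, Matrix.zero_apply, Finset.sum_const_zero, mul_zero] at hle
    exact (entrySum_pow_pos hM hM' n).not_ge hle
  have hle := growthExp_le_add_log hM (restrictRows_nonneg hM _) hM' hnil one_pos
    (hfreq.mono fun n hn => by rwa [one_pow, mul_one])
  exact ⟨i, hi, hnil, by simpa using hle⟩

end Reachable

section Recurrence

variable {d : ℕ} {ν M : Matrix (Fin d) (Fin d) ℝ}

theorem apply_eq_zero_of_forall_apply_eq_zero (hν : ν ∈ MarkovDist d) {C : Set (Fin d)}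
    (hC : ∀ i ∈ C, ∀ j ∉ C, ν i j = 0) : ∀ i ∉ C, ∀ j ∈ C, ν i j = 0 := by
  classical
  have hout : ∑ j ∈ C.toFinset, ∑ i ∈ C.toFinsetᶜ, ν j i = 0 :=
    Finset.sum_eq_zero fun j hj => Finset.sum_eq_zero fun i hi => by
      simp only [Finset.mem_compl, Set.mem_toFinset] at hi hj
      exact hC j hj i hi
  have hbalance : ∑ j ∈ C.toFinset, ∑ i, ν j i = ∑ j ∈ C.toFinset, ∑ i, ν i j :=
    Finset.sum_congr rfl fun j _ => hν.2.2 j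
  have hinside : ∑ j ∈ C.toFinset, ∑ i ∈ C.toFinset, ν j i =
      ∑ j ∈ C.toFinset, ∑ i ∈ C.toFinset, ν i j := Finset.sum_comm
  simp only [← Finset.sum_add_sum_compl C.toFinset, Finset.sum_add_distrib, hout, hinside,
    add_zero, left_eq_add] at hbalance
  intro i hi j hj
  have hin := (Finset.sum_eq_zero_iff_of_nonneg fun j _ =>
    Finset.sum_nonneg fun i _ => hν.1 i j).1 hbalance j (by simpa using hj)
  exact (Finset.sum_eq_zero_iff_of_nonneg fun i _ => hν.1 i j).1 hin i (by simpa using hi)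

theorem mem_reachable_symm (hν : ν ∈ MarkovDist d) (hM : ∀ i j, 0 ≤ M i j)
    (hMν : ∀ i j, 0 < M i j ↔ 0 < ν i j) (i j : Fin d) (hij : j ∈ reachable M i) :
    i ∈ reachable M j := by
  have hinto : ∀ a b, 0 < M a b → b ∈ reachable M j → a ∈ reachable M j := fun a b hab hb => by
    by_contra ha
    refine ((hMν a b).1 hab).ne' (apply_eq_zero_of_forall_apply_eq_zero hν (fun x hx y hy => ?_)
      a ha b hb)
    refine (hν.1 x y).eq_of_not_lt' fun hxy => ((hMν x y).2 hxy).ne' ?_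
    exact apply_eq_zero_of_mem_reachable hM x hx y hy
  obtain ⟨n, hn, hpos⟩ := hij
  have hjj : j ∈ reachable M j := by
    rw [← Nat.succ_pred_eq_of_pos hn, pow_succ] at hpos
    obtain ⟨a, -, ha⟩ := exists_pos_of_mul_apply_pos (Matrix.pow_apply_nonneg hM _) hM hpos
    obtain ⟨b, hb⟩ := exists_pos_of_rowSum_pos (rowSum_pos_of_pos' hν ((hMν a j).1 ha))
    have hjb := (hMν j b).2 hb
    exact hinto j b hjb (mem_reachable_of_apply_pos hjb)
  clear hn
  induction n generalizing i with
  | zero =>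
    rw [pow_zero, Matrix.one_apply] at hpos
    rwa [(ite_ne_right_iff.1 hpos.ne').1]
  | succ n ih =>
    rw [pow_succ'] at hpos
    obtain ⟨a, hia, haj⟩ := exists_pos_of_mul_apply_pos hM (Matrix.pow_apply_nonneg hM _) hpos
    exact hinto i a hia (ih a haj)

end Recurrence

section NearMinimizers

variable {ι : Type*} [Fintype ι] [DecidableEq ι] {M A B D : Matrix ι ι ℝ} {w : ι → ℝ} {α c : ℝ}

theorem growthExp_geomMean_mono_left (hα : 0 ≤ α) (hA : ∀ i j, 0 ≤ A i j) (hD : ∀ i j, 0 ≤ D i j)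
    (h : ∀ i j, A i j ≤ B i j) (hAD : ¬ IsNilpotent (geomMean α A D)) :
    growthExp (geomMean α A D) ≤ growthExp (geomMean α B D) :=
  growthExp_mono (geomMean_nonneg hA hD) hAD fun i j =>
    mul_le_mul_of_nonneg_right (Real.rpow_le_rpow (hA i j) (h i j) hα) (Real.rpow_nonneg (hD i j) _)

theorem growthExp_diagConj_div_add_geomMean (hα0 : α ≠ 0) (hα1 : α ≠ 1) (hc : 0 < c)
    (hw : ∀ i, 0 < w i) (hM : ∀ i j, 0 ≤ M i j) (hM' : ¬ IsNilpotent M) :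
    growthExp (diagConj c w M) / α + growthExp (geomMean α M (diagConj c w M)) / (α * (α - 1)) =
      growthExp M / (α - 1) := by
  rw [geomMean_self_diagConj hc hw hM, growthExp_diagConj hc hw hM hM',
    growthExp_diagConj (Real.rpow_pos_of_pos hc _) (fun i => Real.rpow_pos_of_pos (hw i) _) hM hM',
    Real.log_rpow hc]
  have := sub_ne_zero.2 hα1
  field_simp
  ring

variable {d : ℕ} {G ν : Matrix (Fin d) (Fin d) ℝ}

theorem exists_growthExp_add_le_of_lt_one (hα0 : α ≠ 0) (hα1 : α < 1) (hν : ν ∈ MarkovDist d) :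
    ∃ θ ∈ MarkovDist d, ∃ r : ℝ, Tendsto (renyiSeq α ν θ) atTop (𝓝 (r : EReal)) ∧
      growthExp (expTilt α G θ) / α + r ≤ growthExp (expTilt (α - 1) G ν) / (α - 1) := by
  set M := expTilt (α - 1) G ν with hMdef
  have hM : ∀ i j, 0 ≤ M i j := expTilt_nonneg _ G hν
  have hsymm := mem_reachable_symm hν hM fun i j => expTilt_pos_iff _ G hν
  have : Nonempty (Fin d) := ⟨(exists_rowSum_pos hν).choose⟩
  obtain ⟨i₀, hi₀, hnil, hle⟩ :=
    exists_growthExp_le_restrictRows hM (not_isNilpotent_expTilt _ G hν) hsymm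
  set C := reachable M i₀
  have hMC := restrictRows_nonneg hM C
  have : Nonempty C := ⟨⟨i₀, hi₀⟩⟩
  have hsub : (restrictRows C M).submatrix (↑) (↑) = (M.submatrix (↑) (↑) : Matrix C C ℝ) :=
    Matrix.ext fun a b => restrictRows_apply_of_mem a.2 M b
  obtain ⟨θ, hθ, c, hc, w, hw, hθM⟩ := exists_expTilt_eq_diagConj α G hMC (C := C)
    (fun i j hij => by
      have hi : i ∈ C := not_imp_comm.1 (restrictRows_apply_of_notMem · M j) hij
      rw [restrictRows_apply_of_mem hi] at hij
      exact ⟨hi, not_imp_comm.1 (apply_eq_zero_of_mem_reachable hM i hi j) hij⟩)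
    (hsub ▸ isIrreducible_submatrix_reachable hM hsymm i₀)
  have hgeom : geomMean α (transMatrix ν) (transMatrix θ) =
      geomMean α (restrictRows C M) (diagConj c w (restrictRows C M)) := by
    rw [← geomMean_expTilt G α hν hθ, hθM]
    ext i j
    by_cases hi : i ∈ C
    · simp only [geomMean_apply, restrictRows_apply_of_mem hi, ← hMdef]
    · simp [geomMean_apply, diagConj_apply, restrictRows_apply_of_notMem hi, sub_ne_zero.2 hα1.ne']
  refine ⟨θ, hθ, _, tendsto_renyiSeq hα0 hα1.ne hν hθ (fun i j => ⟨fun h => absurd h hα1.not_gt,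
    fun _ hij => ?_⟩) ?_, ?_⟩
  · rw [← expTilt_eq_zero_iff α G hθ, hθM, diagConj_apply]
    have h0 : M i j = 0 := (expTilt_eq_zero_iff _ G hν).2 hij
    rw [((restrictRows_le hM C i j).trans_eq h0).antisymm (hMC i j), zero_mul, mul_zero]
  · rw [hgeom, geomMean_self_diagConj hc hw hMC]
    exact not_isNilpotent_diagConj (Real.rpow_pos_of_pos hc _)
      (fun i => Real.rpow_pos_of_pos (hw i) _) hMC hnil
  · rw [hgeom, hθM, growthExp_diagConj_div_add_geomMean hα0 hα1.ne hc hw hMC hnil]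
    exact div_le_div_of_nonpos_of_le (sub_nonpos.2 hα1.le) hle

theorem exists_growthExp_add_le_of_one_lt (hα : 1 < α) (hν : ν ∈ MarkovDist d) {δ : ℝ}
    (hδ : 0 < δ) :
    ∃ θ ∈ MarkovDist d, ∃ r : ℝ, Tendsto (renyiSeq α ν θ) atTop (𝓝 (r : EReal)) ∧
      growthExp (expTilt α G θ) / α + r ≤ growthExp (expTilt (α - 1) G ν) / (α - 1) + δ := by
  have hα0 : 0 < α := one_pos.trans hα
  have hα1 : 0 < α - 1 := sub_pos.2 hα
  set M := expTilt (α - 1) G ν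
  have hM : ∀ i j, 0 ≤ M i j := expTilt_nonneg _ G hν
  have hM' : ¬ IsNilpotent M := not_isNilpotent_expTilt _ G hν
  obtain ⟨ε, hε, hle⟩ := exists_growthExp_add_smul_le (E := Matrix.of fun _ _ => 1) hM
    (fun _ _ => zero_le_one) hM' (mul_pos hα1 hδ)
  set L := M + ε • Matrix.of fun _ _ => (1 : ℝ) with hL
  have hML : ∀ i j, M i j < L i j := fun i j => by simpa [hL] using hε
  have hLpos : ∀ i j, 0 < L i j := fun i j => (hM i j).trans_lt (hML i j)
  have hLnil := not_isNilpotent_of_forall_pos hM (fun i j => (hLpos i j).le)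
    (fun i j _ => hLpos i j) hM'
  have : Nonempty (Set.univ : Set (Fin d)) := ⟨⟨(exists_rowSum_pos hν).choose, trivial⟩⟩
  obtain ⟨θ, hθ, c, hc, w, hw, hθL⟩ := exists_expTilt_eq_diagConj α G (fun i j => (hLpos i j).le)
    (C := Set.univ) (fun _ _ _ => ⟨trivial, trivial⟩)
    ((Matrix.isIrreducible_iff_exists_pow_pos (A := L.submatrix Subtype.val Subtype.val)
      fun i j => (hLpos i.1 j.1).le).2 fun i j =>
        ⟨1, one_pos, by rw [pow_one]; exact hLpos i.1 j.1⟩)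
  have hD : ∀ i j, 0 < diagConj c w L i j := fun i j => (diagConj_pos_iff hc hw).2 (hLpos i j)
  have hgeom : geomMean α (transMatrix ν) (transMatrix θ) = geomMean α M (diagConj c w L) := by
    rw [← geomMean_expTilt G α hν hθ, hθL]
  have hnil := not_isNilpotent_geomMean (α := α) hM (fun i j => (hD i j).le) hM' fun i j _ => hD i j
  refine ⟨θ, hθ, _, tendsto_renyiSeq hα0.ne' hα.ne' hν hθ (fun i j => ⟨fun _ hij => ?_,
    fun h => absurd h hα0.not_gt⟩) (hgeom ▸ hnil), ?_⟩
  · rw [← expTilt_eq_zero_iff α G hθ, hθL] at hij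
    exact absurd hij (hD i j).ne'
  rw [hgeom, hθL]
  calc growthExp (diagConj c w L) / α + growthExp (geomMean α M (diagConj c w L)) / (α * (α - 1))
      ≤ growthExp (diagConj c w L) / α +
          growthExp (geomMean α L (diagConj c w L)) / (α * (α - 1)) := by
        gcongr
        exact growthExp_geomMean_mono_left hα0.le hM (fun i j => (hD i j).le)
          (fun i j => (hML i j).le) hnil
    _ = growthExp L / (α - 1) := growthExp_diagConj_div_add_geomMean hα0.ne' hα.ne' hc hw
        (fun i j => (hLpos i j).le) hLnil
    _ ≤ growthExp M / (α - 1) + δ := by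
        rw [div_le_iff₀ hα1, add_mul, div_mul_cancel₀ _ hα1.ne', mul_comm δ]
        exact hle

end NearMinimizers

section Variational

variable {d : ℕ} {α : ℝ} {G ν θ : Matrix (Fin d) (Fin d) ℝ}

theorem coe_mul_growthRate_expTilt (a c : ℝ) (G : Matrix (Fin d) (Fin d) ℝ)
    (hν : ν ∈ MarkovDist d) :
    (a : EReal) * growthRate (expTilt c G ν) = ((a * growthExp (expTilt c G ν) : ℝ) : EReal) := by
  rw [growthRate_expTilt c G hν, EReal.coe_mul]

theorem growthRate_expTilt_le_add_renyiRate (hα0 : α ≠ 0) (hα1 : α ≠ 1) (hν : ν ∈ MarkovDist d)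
    (hθ : θ ∈ MarkovDist d) :
    ((1 / (α - 1) : ℝ) : EReal) * growthRate (expTilt (α - 1) G ν) ≤
      ((1 / α : ℝ) : EReal) * growthRate (expTilt α G θ) + renyiRate α ν θ := by
  rw [coe_mul_growthRate_expTilt _ _ G hν, coe_mul_growthRate_expTilt _ _ G hθ, renyiRate]
  rcases tendsto_renyiSeq_cases hα0 hα1 hν hθ with h | ⟨hfin, hnil, h⟩
  · rw [h.limUnder_eq, EReal.coe_add_top]
    exact le_top
  · rw [← geomMean_expTilt G α hν hθ] at h hnil
    rw [h.limUnder_eq, one_div_mul_eq_div, one_div_mul_eq_div]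
    have hle := growthExp_div_le hα0 hα1 (expTilt_nonneg (α - 1) G hν) (expTilt_nonneg α G hθ)
      (not_isNilpotent_expTilt _ G hν) (not_isNilpotent_expTilt _ G hθ) hnil fun i j => by
        simpa only [RenyiFinite, expTilt_eq_zero_iff _ G hν, expTilt_eq_zero_iff _ G hθ]
          using hfin i j
    exact_mod_cast hle

theorem exists_add_renyiRate_le (hα0 : α ≠ 0) (hα1 : α ≠ 1) (hν : ν ∈ MarkovDist d) {δ : ℝ}
    (hδ : 0 < δ) :
    ∃ θ ∈ MarkovDist d, ((1 / α : ℝ) : EReal) * growthRate (expTilt α G θ) + renyiRate α ν θ ≤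
      ((1 / (α - 1) * growthExp (expTilt (α - 1) G ν) + δ : ℝ) : EReal) := by
  obtain ⟨θ, hθ, r, hr, hle⟩ : ∃ θ ∈ MarkovDist d, ∃ r : ℝ,
      Tendsto (renyiSeq α ν θ) atTop (𝓝 (r : EReal)) ∧
        growthExp (expTilt α G θ) / α + r ≤
          growthExp (expTilt (α - 1) G ν) / (α - 1) + δ := by
    rcases lt_or_gt_of_ne hα1 with h | h
    · obtain ⟨θ, hθ, r, hr, hle⟩ := exists_growthExp_add_le_of_lt_one (G := G) hα0 h hν
      exact ⟨θ, hθ, r, hr, hle.trans (le_add_of_nonneg_right hδ.le)⟩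
    · exact exists_growthExp_add_le_of_one_lt h hν hδ
  refine ⟨θ, hθ, ?_⟩
  rw [coe_mul_growthRate_expTilt _ _ G hθ, renyiRate, hr.limUnder_eq, one_div_mul_eq_div,
    one_div_mul_eq_div]
  exact_mod_cast hle

theorem growthRate_expTilt_eq_iInf (hα0 : α ≠ 0) (hα1 : α ≠ 1) (G : Matrix (Fin d) (Fin d) ℝ)
    (hν : ν ∈ MarkovDist d) :
    ((1 / (α - 1) : ℝ) : EReal) * growthRate (expTilt (α - 1) G ν) =
      ⨅ θ ∈ MarkovDist d,
        (((1 / α : ℝ) : EReal) * growthRate (expTilt α G θ) + renyiRate α ν θ) := by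
  refine le_antisymm
    (le_iInf₂ fun θ hθ => growthRate_expTilt_le_add_renyiRate hα0 hα1 hν hθ) ?_
  rw [coe_mul_growthRate_expTilt _ _ G hν]
  refine EReal.le_of_forall_lt_iff_le.1 fun z hz => ?_
  obtain ⟨θ, hθ, hle⟩ := exists_add_renyiRate_le (G := G) hα0 hα1 hν
    (sub_pos.2 (EReal.coe_lt_coe_iff.1 hz))
  rw [add_sub_cancel] at hle
  exact (iInf₂_le θ hθ).trans hle

theorem expTilt_neg_neg (c : ℝ) (G ν : Matrix (Fin d) (Fin d) ℝ) :
    expTilt (-c) (-G) ν = expTilt c G ν := by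
  simp only [expTilt, Matrix.neg_apply, neg_mul_neg]

theorem renyiRate_one_sub (hα0 : α ≠ 0) (hα1 : α ≠ 1) (hν : ν ∈ MarkovDist d)
    (hθ : θ ∈ MarkovDist d) : renyiRate (1 - α) θ ν = renyiRate α ν θ := by
  rw [renyiRate, renyiSeq_one_sub hα0 hα1 hν hθ, renyiRate]

theorem ereal_neg_iInf₂ {ι : Sort*} {κ : ι → Sort*} (f : ∀ i, κ i → EReal) :
    -(⨅ i, ⨅ j, f i j) = ⨆ i, ⨆ j, -f i j :=
  EReal.negOrderIso.map_iInf₂ f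

-- The infimum formula of order `1 - α` for `-G`, multiplied by `-1`.
theorem growthRate_expTilt_eq_iSup (hα0 : α ≠ 0) (hα1 : α ≠ 1) (G : Matrix (Fin d) (Fin d) ℝ)
    (hθ : θ ∈ MarkovDist d) :
    ((1 / α : ℝ) : EReal) * growthRate (expTilt α G θ) =
      ⨆ ν ∈ MarkovDist d,
        (((1 / (α - 1) : ℝ) : EReal) * growthRate (expTilt (α - 1) G ν) - renyiRate α ν θ) := by
  have hinf := growthRate_expTilt_eq_iInf (sub_ne_zero.2 hα1.symm) (by simpa using hα0) (-G) hθ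
  rw [sub_sub_cancel_left, ← neg_sub α 1, expTilt_neg_neg, one_div_neg_eq_neg_one_div,
    one_div_neg_eq_neg_one_div, EReal.coe_neg, EReal.coe_neg, EReal.neg_mul] at hinf
  rw [← neg_neg (_ * growthRate (expTilt α G θ)), hinf, ereal_neg_iInf₂]
  refine biSup_congr fun ν hν => ?_
  rw [neg_sub, renyiRate_one_sub hα0 hα1 hν hθ, ← neg_sub α 1, expTilt_neg_neg, EReal.neg_mul,
    coe_mul_growthRate_expTilt _ _ G hν,
    ← EReal.neg_sub (.inl (EReal.coe_ne_bot _)) (.inl (EReal.coe_ne_top _)), neg_neg]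

end Variational

/-- The first two conjuncts say that the limits defining the growth rate and the Rényi divergence
rate exist; the third says that the growth rates that occur are finite, so that no expression
`∞ - ∞` arises; the last two are the variational formulas. -/
theorem mainTheorem4 (d : ℕ) (α : ℝ) (hα0 : α ≠ 0) (hα1 : α ≠ 1)
    (G : Matrix (Fin d) (Fin d) ℝ) :
    (∀ M : Matrix (Fin d) (Fin d) ℝ, (∀ i j, 0 ≤ M i j) →
      ∃ l : EReal, Tendsto (growthSeq M) atTop (𝓝 l)) ∧
    (∀ ν ∈ MarkovDist d, ∀ θ ∈ MarkovDist d,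
      ∃ l : EReal, Tendsto (renyiSeq α ν θ) atTop (𝓝 l)) ∧
    (∀ ν ∈ MarkovDist d, ∀ c : ℝ,
      growthRate (expTilt c G ν) ≠ ⊥ ∧ growthRate (expTilt c G ν) ≠ ⊤) ∧
    (∀ ν ∈ MarkovDist d,
      ((1 / (α - 1) : ℝ) : EReal) * growthRate (expTilt (α - 1) G ν) =
        ⨅ θ ∈ MarkovDist d,
          (((1 / α : ℝ) : EReal) * growthRate (expTilt α G θ) + renyiRate α ν θ)) ∧
    (∀ θ ∈ MarkovDist d,
      ((1 / α : ℝ) : EReal) * growthRate (expTilt α G θ) =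
        ⨆ ν ∈ MarkovDist d,
          (((1 / (α - 1) : ℝ) : EReal) * growthRate (expTilt (α - 1) G ν) -
            renyiRate α ν θ)) := by
  refine ⟨fun M hM => exists_tendsto_growthSeq hM,
    fun ν hν θ hθ => exists_tendsto_renyiSeq hα0 hα1 hν hθ, fun ν hν c => ?_,
    fun ν hν => growthRate_expTilt_eq_iInf hα0 hα1 G hν,
    fun θ hθ => growthRate_expTilt_eq_iSup hα0 hα1 G hθ⟩
  rw [growthRate_expTilt c G hν]
  exact ⟨EReal.coe_ne_bot _, EReal.coe_ne_top _⟩
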